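/- Let $\mathbb K\in\{\mathbb R,\mathbb C\}$, let $1\le p<\infty$, and let $\rho\ne0$ be a nonnegative Radon measure on $\mathbb R$ with $\|\rho\|_{\mathrm{unif}}<\infty$ which is periodic, that is, the set $\operatorname{Per}(\rho)=\{s\in\mathbb R\setminus\{0\}:\rho(\cdot+s)=\rho\}$ is nonempty. Here $\|\nu\|_{\mathrm{unif}}=\sup_{t\in\mathbb R}|\nu|((t,t+1])$ for a local measure $\nu$, with $|\nu|$ its total variation. A real local measure is a real set function on the bounded Borel subsets of $\mathbb R$ whose restriction to every compact set is a finite signed measure. We write $\int_s^t$ for the integral over $(s,t]$ if $s\le t$ and for minus the integral over $(t,s]$ if $t<s$. A function $f:\mathbb R\to\mathbb K$ is locally absolutely continuous with respect to $\rho$, with $\partial_\rho f=h$, if $h\in L_{1,\mathrm{loc}}(\mathbb R,\rho)$ and $f(t)=f(c)+\int_c^t h\,d\rho$ for all $t\in\mathbb R$, for some $c\in\mathbb R$. Let $a:\mathbb R\to[0,\infty)$ satisfy $a,\frac1a\in L_\infty(\mathbb R)$ (in particular $a>0$ a.e.), and let $\mu$ be a real local measure with $\|\mu\|_{\mathrm{unif}}<\infty$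 and $\operatorname{spt}\mu\subseteq\operatorname{spt}\rho$. Let $H$ be the operator in $L_p(\mathbb R,\rho)$ whose domain consists of those $u\in L_p(\mathbb R,\rho)$ with $u\in W^1_{1,\mathrm{loc}}(\mathbb R)$ (continuous representative) for which $$A_{a,\mu}u(t)=-(au')(t)+\int_0^t u\,d\mu$$ agrees for a.e. $t$ with a function that is locally absolutely continuous with respect to $\rho$ and has $\partial_\rho A_{a,\mu}u\in L_p(\mathbb R,\rho)$; put $Hu=\partial_\rho A_{a,\mu}u$. For $I\subseteq\mathbb R$ and a real local measure $\nu$ let $$\|\nu\|_I=\sup\Big\{\Big|\int u\,d\nu\Big| : u\in W^1_{1,\mathrm{loc}}(\mathbb R),\ \operatorname{spt}u\subseteq I,\ \operatorname{diam}\operatorname{spt}u\le2,\ \|u'\|_\infty\le1\Big\}.$$ Let $C>0$ and let $(p_m)$ be a sequence of positive elements of $\operatorname{Per}(\rho)$ with $p_m\to\infty$ and $$\lim_{m\to\infty}e^{Cp_m}\Big(\|a-a(\cdot+p_m)\|_{L_1(-p_m,p_m)}+\|\mu-\mu(\cdot+p_m)\|_{[-p_m,p_m]}\Big)=0 .$$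 Then $H$ has no eigenvalue $z\in\mathbb K$ with $$|z|<\frac{1}{\|\rho\|_{\mathrm{unif}}}\Big(\big\|\tfrac1a\big\|_\infty^{-1}C^2-\|\mu\|_{\mathrm{unif}}\Big).$$ -/

import Mathlib

open MeasureTheory Filter Topology Set
open scoped ENNReal

noncomputable section

/-- A real local measure `μ` on `ℝ` (a real-valued set function on the bounded Borel sets whose
restriction to each compact set is a finite signed Radon measure), given by its Jordan decomposition
`μ = pos - neg` into two mutually singular nonnegative Radon measures. This decomposition exists and
is unique, so that such pairs are the same thing as real local measures. -/
structure RealLocalMeasure where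
  /-- the positive part -/
  pos : Measure ℝ
  /-- the negative part -/
  neg : Measure ℝ
  pos_locallyFinite : IsLocallyFiniteMeasure pos
  neg_locallyFinite : IsLocallyFiniteMeasure neg
  mutuallySingular : pos ⟂ₘ neg

/-- The translate `ν(· + s)` of a nonnegative measure, `B ↦ ν (B + s)`. -/
def translateMeasure (ν : Measure ℝ) (s : ℝ) : Measure ℝ :=
  ν.map (fun x => x - s)

theorem translateMeasure_locallyFinite (ν : Measure ℝ) [IsLocallyFiniteMeasure ν] (s : ℝ) :
    IsLocallyFiniteMeasure (translateMeasure ν s) := by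
  refine ⟨fun x => ?_⟩
  obtain ⟨U, hU, hfin⟩ := ν.exists_isOpen_measure_lt_top (x + s)
  have hopen : IsOpen ((fun y : ℝ => y + s) ⁻¹' U) := hfin.1.preimage (continuous_add_const s)
  refine ⟨(fun y : ℝ => y + s) ⁻¹' U, hopen.mem_nhds hU, ?_⟩
  unfold translateMeasure
  rw [Measure.map_apply (by fun_prop : Measurable fun x : ℝ => x - s) hopen.measurableSet]
  have : (fun x : ℝ => x - s) ⁻¹' ((fun y : ℝ => y + s) ⁻¹' U) = U := by
    ext y
    simp
  rw [this]
  exact hfin.2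

theorem translateMeasure_mutuallySingular {ν₁ ν₂ : Measure ℝ} (h : ν₁ ⟂ₘ ν₂) (s : ℝ) :
    translateMeasure ν₁ s ⟂ₘ translateMeasure ν₂ s := by
  obtain ⟨t, ht, h1, h2⟩ := h
  have hm : Measurable fun y : ℝ => y + s := measurable_id.add_const s
  have key : ∀ A : Set ℝ, (fun x : ℝ => x - s) ⁻¹' ((fun y : ℝ => y + s) ⁻¹' A) = A := by
    intro A
    ext y
    simp
  refine ⟨(fun y : ℝ => y + s) ⁻¹' t, hm ht, ?_, ?_⟩
  · unfold translateMeasure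
    rw [Measure.map_apply (by fun_prop : Measurable fun x : ℝ => x - s) (hm ht), key, h1]
  · unfold translateMeasure
    rw [← preimage_compl, Measure.map_apply (by fun_prop : Measurable fun x : ℝ => x - s) (hm ht.compl), key, h2]

namespace RealLocalMeasure

/-- The total variation `|μ|`. -/
def variation (μ : RealLocalMeasure) : Measure ℝ := μ.pos + μ.neg

/-- The translate `μ(· + s)`, `B ↦ μ (B + s)`. -/
def translate (μ : RealLocalMeasure) (s : ℝ) : RealLocalMeasure where
  pos := translateMeasure μ.pos s
  neg := translateMeasure μ.neg s
  pos_locallyFinite :=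
    haveI := μ.pos_locallyFinite
    translateMeasure_locallyFinite μ.pos s
  neg_locallyFinite :=
    haveI := μ.neg_locallyFinite
    translateMeasure_locallyFinite μ.neg s
  mutuallySingular := translateMeasure_mutuallySingular μ.mutuallySingular s

/-- `∫ u dμ` over all of `ℝ`; used for continuous functions with compact support. -/
def integral (μ : RealLocalMeasure) (u : ℝ → ℝ) : ℝ :=
  (∫ x, u x ∂μ.pos) - ∫ x, u x ∂μ.neg

/-- `∫_s^t u dμ`, which is the integral over `(s, t]` if `s ≤ t`, and minus the integral over
`(t, s]` if `t < s`. -/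
def integralBetween {𝕜 : Type*} [RCLike 𝕜] (μ : RealLocalMeasure) (u : ℝ → 𝕜) (s t : ℝ) : 𝕜 :=
  (∫ x in s..t, u x ∂μ.pos) - ∫ x in s..t, u x ∂μ.neg

end RealLocalMeasure

/-- `‖ν‖_unif = sup_t ν((t, t+1])` for a nonnegative measure `ν`. The norm `‖μ‖_unif` of a real local
measure is `unifNorm μ.variation`. -/
def unifNorm (ν : Measure ℝ) : ℝ≥0∞ := ⨆ t : ℝ, ν (Ioc t (t + 1))

/-- The set `Per(ρ)` of (positive or negative) periods of `ρ`. -/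
def periods (ρ : Measure ℝ) : Set ℝ := {s | s ≠ 0 ∧ translateMeasure ρ s = ρ}

/-- `f` is locally absolutely continuous with respect to `ν`, with derivative `∂_ν f = h`.
With `ν` the Lebesgue measure this says `f ∈ W^1_{1,loc}(ℝ)` (`f` being the continuous
representative) and `f' = h`. -/
def HasRNDeriv {𝕜 : Type*} [RCLike 𝕜] (ν : Measure ℝ) (f h : ℝ → 𝕜) : Prop :=
  LocallyIntegrable h ν ∧ ∃ c : ℝ, ∀ t : ℝ, f t = f c + ∫ s in c..t, h s ∂ν

/-- The admissible functions in the seminorm `‖·‖_I`: those `u ∈ W^1_{1,loc}(ℝ)` with `spt u ⊆ I`,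
`diam spt u ≤ 2` and `‖u'‖_∞ ≤ 1`. -/
def seminormTests (I : Set ℝ) : Set (ℝ → ℝ) :=
  {u | tsupport u ⊆ I ∧ Metric.ediam (tsupport u) ≤ 2 ∧
    ∃ g : ℝ → ℝ, HasRNDeriv volume u g ∧ eLpNorm g ∞ volume ≤ 1}

/-- The Wasserstein-type seminorm `‖μ - ν‖_I = sup |∫ u dμ - ∫ u dν|` of a difference of real local
measures. -/
def seminormSub (I : Set ℝ) (μ ν : RealLocalMeasure) : ℝ≥0∞ :=
  ⨆ u ∈ seminormTests I, ENNReal.ofReal |μ.integral u - ν.integral u|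

/-- The class `AM(ℝ)` of coefficients belonging to the weight `ρ`. -/
structure IsAM (ρ : Measure ℝ) (a : ℝ → ℝ) (μ : RealLocalMeasure) : Prop where
  a_nonneg : ∀ t, 0 ≤ a t
  /-- `1 / a` is defined almost everywhere -/
  a_pos : ∀ᵐ t ∂volume, 0 < a t
  a_bounded : MemLp a ∞ volume
  inv_a_bounded : MemLp (fun t => 1 / a t) ∞ volume
  unif_bounded : unifNorm μ.variation < ∞
  support_subset : μ.variation.support ⊆ ρ.support

/-- The weak Gordon condition with weight `C` along the sequence `per`. -/
structure WeakGordonAlong (a : ℝ → ℝ) (μ : RealLocalMeasure) (C : ℝ) (per : ℕ → ℝ) : Prop where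
  per_pos : ∀ m, 0 < per m
  per_tendsto : Tendsto per atTop atTop
  tendsto_zero : Tendsto (fun m =>
      ENNReal.ofReal (Real.exp (C * per m)) *
        (eLpNorm (fun t => a t - a (t + per m)) 1 (volume.restrict (Ioo (-per m) (per m))) +
          seminormSub (Icc (-per m) (per m)) μ (μ.translate (per m))))
    atTop (𝓝 0)

section Operator

variable {𝕜 : Type*} [RCLike 𝕜]

/-- `A_{a,μ} u (t) = -(a u')(t) + ∫_0^t u dμ`, where `u'` is the weak derivative of `u`. -/
def slPrimitive (a : ℝ → ℝ) (μ : RealLocalMeasure) (u u' : ℝ → 𝕜) (t : ℝ) : 𝕜 :=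
  -((a t : 𝕜) * u' t) + μ.integralBetween u 0 t

/-- `u ∈ D_{ρ,a,μ}(ℝ)` and `∂_ρ A_{a,μ} u = h`. As `A_{a,μ} u` is only defined almost everywhere, its
local absolute continuity with respect to `ρ` refers to a representative `w`. -/
def HasSLImage (ρ : Measure ℝ) (a : ℝ → ℝ) (μ : RealLocalMeasure) (u h : ℝ → 𝕜) : Prop :=
  ∃ u' w : ℝ → 𝕜, HasRNDeriv volume u u' ∧ w =ᵐ[volume] slPrimitive a μ u u' ∧ HasRNDeriv ρ w h

variable (𝕜) in
/-- The graph of the Sturm–Liouville operator `H_{p,ρ,a,μ}` in `L_p(ℝ, ρ)`: the pairs `(f, H f)` for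
`f` in the domain of `H`. -/
def slGraph (p : ℝ≥0∞) (ρ : Measure ℝ) (a : ℝ → ℝ) (μ : RealLocalMeasure) :
    Set (Lp 𝕜 p ρ × Lp 𝕜 p ρ) :=
  {F | ∃ u : ℝ → 𝕜, u =ᵐ[ρ] F.1 ∧ HasSLImage ρ a μ u F.2}

/-- `z` is an eigenvalue of `H_{p,ρ,a,μ}`: there is `f ≠ 0` in the domain with `H f = z f`. -/
def IsSLEigenvalue (p : ℝ≥0∞) (ρ : Measure ℝ) (a : ℝ → ℝ) (μ : RealLocalMeasure) (z : 𝕜) : Prop :=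
  ∃ f : Lp 𝕜 p ρ, f ≠ 0 ∧ (f, z • f) ∈ slGraph 𝕜 p ρ a μ

end Operator

end

/-!
An eigenfunction `u` with `H u = z u` is, together with a version `v` of `a u'`, a solution of the
first order system `u' = q v`, `dv = u d(μ - z ρ)` with `q = 1 / a`. The proof compares `(u, v)` on
`[-p, 0]`, `[0, p]` and `[p, 2p]`, for `p` in the given sequence of periods.

*Growth.* If `0 ≤ q ≤ A` and the total variation of `μ - z ρ` has mass at most `N` on unit intervals,
then solutions grow at most like `exp (κ |t - s|)` as soon as `A N ≤ κ²`
(`IsSystem.norm_solution_le_exp`). That the rate is `√(A N)`, although the mass may be concentrated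
in atoms, is due to the Riccati inequality `dr ≤ dθ - A r² dt` for the quotient `r` of majorants of
`v` and `u` (`log_majorant_le`). The condition on `z` says that `A N < C²` for
`N = ‖μ‖_unif + |z| ‖ρ‖_unif`, which leaves room for some `κ < C`.

*Comparison.* The weak seminorm of `μ - μ(· + p)` controls, up to a factor quadratic in `p`, the
distance in `L₁(-p, p)` of a primitive of `μ(· + p) - μ` to a constant
(`exists_integral_abs_cdf_sub_le`). Replacing `v` by `v - E u`, where `E` is that primitive minus the
constant, turns the perturbation of the measure into an `L₁` perturbation, and Duhamel's formula in
terms of the Wronskian bounds the distance of solutions of the original and the translated system by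
`exp (κ p)` times the size of the perturbation (`norm_solution_sub_le`). Since `κ < C`, the Gordon
condition makes this bound tend to zero. The values of `v` can be compared only at points where `E`
is small; such points exist in every unit interval.

*Decay.* As `u` is in `L_p(ρ)`, `ρ` is periodic and `μ` lives on the support of `ρ`, both `u` and `v`
tend to zero at infinity (`IsSystem.exists_forall_norm_le`).

*Three blocks.* Let `M` be the transfer matrix of the system over `[c, c + p]` and `x = (u, v)(c)`.
It has determinant one, so `M² x - (tr M) M x + x = 0` and `‖x‖ ≤ ‖M⁻¹ x‖ + ‖M x‖ + ‖M² x‖`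
(`IsSystem.norm_le_three_blocks`). Here `M x = (u, v)(c + p)`, while `M⁻¹ x` and `M² x` are close to
`(u, v)(c - p)` and `(u, v)(c + 2p)` by the comparison, up to bounded factors. All three tend to zero
with `p → ∞`, whereas `x` stays away from zero unless `u = 0`.
-/

/-! ### Primitives with respect to a measure -/

/-- Integration by parts on `[s, t]`, for a primitive `F` with respect to Lebesgue measure and a
primitive `G` with respect to an arbitrary measure `θ`. Since Lebesgue measure has no atoms, no
correction for the jumps of `G` appears. -/
theorem mul_sub_mul_eq_integral_add_integral {𝕜 : Type*} [RCLike 𝕜] {θ : Measure ℝ} [SFinite θ]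
    {F f G g : ℝ → 𝕜} {s t : ℝ} (hst : s ≤ t)
    (hf : IntervalIntegrable f volume s t) (hF : ∀ x ∈ Icc s t, F x = F s + ∫ r in s..x, f r)
    (hg : IntervalIntegrable g θ s t) (hG : ∀ x ∈ Icc s t, G x = G s + ∫ r in s..x, g r ∂θ) :
    IntervalIntegrable (fun r => f r * G r) volume s t ∧
    IntervalIntegrable (fun r => F r * g r) θ s t ∧
    F t * G t - F s * G s = (∫ r in s..t, f r * G r) + ∫ r in s..t, F r * g r ∂θ := by
  have hf' : Integrable f (volume.restrict (Ioc s t)) := hf.1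
  have hg' : Integrable g (θ.restrict (Ioc s t)) := hg.1
  set D : Set (ℝ × ℝ) := {z | z.2 ≤ z.1} with hD
  have hDm : MeasurableSet D := measurableSet_le measurable_snd measurable_fst
  have hint : Integrable (D.indicator fun z : ℝ × ℝ => f z.1 * g z.2)
      ((volume.restrict (Ioc s t)).prod (θ.restrict (Ioc s t))) :=
    (hf'.mul_prod hg').indicator hDm
  have hx : ∀ r ∈ Ioc s t,
      ∫ x in Ioc s t, D.indicator (fun z : ℝ × ℝ => f z.1 * g z.2) (r, x) ∂θ
        = f r * (G r - G s) := by
    intro r hr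
    have h1 : ∀ x, D.indicator (fun z : ℝ × ℝ => f z.1 * g z.2) (r, x)
        = f r * (Iic r).indicator g x := by
      intro x
      by_cases h : x ≤ r <;> simp [hD, indicator, h]
    simp_rw [h1]
    rw [integral_const_mul, setIntegral_indicator measurableSet_Iic]
    have : Ioc s t ∩ Iic r = Ioc s r := by
      ext y; simp only [mem_inter_iff, mem_Ioc, mem_Iic]
      constructor
      · rintro ⟨⟨h, _⟩, h'⟩; exact ⟨h, h'⟩
      · rintro ⟨h, h'⟩; exact ⟨⟨h, h'.trans hr.2⟩, h'⟩
    rw [this, hG r ⟨hr.1.le, hr.2⟩, intervalIntegral.integral_of_le hr.1.le]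
    ring
  have hr : ∀ x ∈ Ioc s t,
      ∫ r in Ioc s t, D.indicator (fun z : ℝ × ℝ => f z.1 * g z.2) (r, x)
        = (F t - F x) * g x := by
    intro x hx
    have h1 : ∀ r, D.indicator (fun z : ℝ × ℝ => f z.1 * g z.2) (r, x)
        = (Ici x).indicator f r * g x := by
      intro r
      by_cases h : x ≤ r <;> simp [hD, indicator, h]
    simp_rw [h1]
    rw [integral_mul_const, setIntegral_indicator measurableSet_Ici]
    have : Ioc s t ∩ Ici x = Icc x t := by
      ext y; simp only [mem_inter_iff, mem_Ioc, mem_Icc, mem_Ici]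
      constructor
      · rintro ⟨⟨_, h⟩, h'⟩; exact ⟨h', h⟩
      · rintro ⟨h, h'⟩; exact ⟨⟨hx.1.trans_le h, h'⟩, h⟩
    rw [this, integral_Icc_eq_integral_Ioc, ← intervalIntegral.integral_of_le hx.2,
      hF t ⟨hst, le_rfl⟩, hF x ⟨hx.1.le, hx.2⟩]
    have h2 : IntervalIntegrable f volume s x :=
      hf.mono_set (by rw [uIcc_of_le hx.1.le, uIcc_of_le hst]; exact Icc_subset_Icc_right hx.2)
    have h3 : IntervalIntegrable f volume x t :=
      hf.mono_set (by rw [uIcc_of_le hx.2, uIcc_of_le hst]; exact Icc_subset_Icc_left hx.1.le)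
    rw [← intervalIntegral.integral_add_adjacent_intervals h2 h3]
    ring
  have I1 : IntegrableOn (fun r => f r * (G r - G s)) (Ioc s t) volume := by
    refine (hint.integral_prod_left).congr ?_
    filter_upwards [ae_restrict_mem measurableSet_Ioc] with r hr' using hx r hr'
  have I2 : IntegrableOn (fun x => (F t - F x) * g x) (Ioc s t) θ := by
    refine (hint.integral_prod_right).congr ?_
    filter_upwards [ae_restrict_mem measurableSet_Ioc] with r hr' using hr r hr'
  have J1 : IntegrableOn (fun r => f r * G r) (Ioc s t) volume := by
    have := I1.add (hf'.mul_const (G s))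
    refine this.congr (ae_of_all _ fun r => ?_)
    simp only [Pi.add_apply]; ring
  have J2 : IntegrableOn (fun r => F r * g r) (Ioc s t) θ := by
    have := (hg'.const_mul (F t)).sub I2
    refine this.congr (ae_of_all _ fun r => ?_)
    simp only [Pi.sub_apply]; ring
  refine ⟨(intervalIntegrable_iff_integrableOn_Ioc_of_le hst).2 J1,
    (intervalIntegrable_iff_integrableOn_Ioc_of_le hst).2 J2, ?_⟩
  have key : ∫ r in Ioc s t, f r * (G r - G s) = ∫ x in Ioc s t, (F t - F x) * g x ∂θ := by
    rw [← setIntegral_congr_fun measurableSet_Ioc hx, ← setIntegral_congr_fun measurableSet_Ioc hr]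
    exact integral_integral_swap hint
  simp_rw [mul_sub, sub_mul] at key
  rw [integral_sub J1 (hf'.mul_const _), integral_sub (hg'.const_mul _) J2, integral_mul_const,
    integral_const_mul, ← intervalIntegral.integral_of_le hst,
    ← intervalIntegral.integral_of_le hst, ← intervalIntegral.integral_of_le hst,
    ← intervalIntegral.integral_of_le hst] at key
  have e1 := hF t ⟨hst, le_rfl⟩
  have e2 := hG t ⟨hst, le_rfl⟩
  have e1' : (∫ r in s..t, f r) = F t - F s := by rw [e1]; ring
  have e2' : (∫ r in s..t, g r ∂θ) = G t - G s := by rw [e2]; ring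
  rw [e1', e2'] at key
  linear_combination -key

theorem locallyIntegrable_of_intervalIntegrable {E : Type*} [NormedAddCommGroup E] {ν : Measure ℝ}
    {h : ℝ → E} (H : ∀ s t, s ≤ t → IntervalIntegrable h ν s t) : LocallyIntegrable h ν := by
  intro x
  exact ⟨Ioc (x - 1) (x + 1), Ioc_mem_nhds (by linarith) (by linarith),
    (H (x - 1) (x + 1) (by linarith)).1⟩

theorem preimage_sub_const_Ioc_sub (p s t : ℝ) :
    (fun x : ℝ => x - p) ⁻¹' Ioc s t = Ioc (s + p) (t + p) := by
  ext x; simp only [mem_preimage, mem_Ioc]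
  constructor <;> rintro ⟨h1, h2⟩ <;> constructor <;> linarith

theorem measurableEmbedding_sub_const (p : ℝ) : MeasurableEmbedding fun x : ℝ => x - p :=
  (Homeomorph.subRight p).measurableEmbedding

theorem translateMeasure_Ioc (ν : Measure ℝ) (p s t : ℝ) :
    translateMeasure ν p (Ioc s t) = ν (Ioc (s + p) (t + p)) := by
  rw [translateMeasure, (measurableEmbedding_sub_const p).map_apply, preimage_sub_const_Ioc_sub]

theorem intervalIntegral_translateMeasure {E : Type*} [NormedAddCommGroup E] [NormedSpace ℝ E]
    (ν : Measure ℝ) (h : ℝ → E) (p s t : ℝ) :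
    ∫ x in s..t, h (x + p) ∂translateMeasure ν p = ∫ x in (s + p)..(t + p), h x ∂ν := by
  simp only [intervalIntegral, translateMeasure]
  rw [(measurableEmbedding_sub_const p).setIntegral_map,
    (measurableEmbedding_sub_const p).setIntegral_map, preimage_sub_const_Ioc_sub,
    preimage_sub_const_Ioc_sub]
  simp

theorem intervalIntegrable_translateMeasure {E : Type*} [NormedAddCommGroup E]
    (ν : Measure ℝ) (h : ℝ → E) (p s t : ℝ) :
    IntervalIntegrable (fun x => h (x + p)) (translateMeasure ν p) s t ↔
      IntervalIntegrable h ν (s + p) (t + p) := by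
  simp only [IntervalIntegrable, translateMeasure]
  rw [(measurableEmbedding_sub_const p).integrableOn_map_iff,
    (measurableEmbedding_sub_const p).integrableOn_map_iff, preimage_sub_const_Ioc_sub,
    preimage_sub_const_Ioc_sub]
  simp [Function.comp_def]

namespace HasRNDeriv

variable {𝕜 : Type*} [RCLike 𝕜] {ν : Measure ℝ} {f h : ℝ → 𝕜}

theorem intervalIntegrable (hf : HasRNDeriv ν f h) (s t : ℝ) : IntervalIntegrable h ν s t :=
  (hf.1.integrableOn_isCompact isCompact_uIcc).intervalIntegrable

theorem sub_eq (hf : HasRNDeriv ν f h) (s t : ℝ) : f t - f s = ∫ x in s..t, h x ∂ν := by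
  obtain ⟨c, hc⟩ := hf.2
  rw [hc t, hc s, ← intervalIntegral.integral_interval_sub_left (hf.intervalIntegrable c t)
    (hf.intervalIntegrable c s)]
  ring

theorem eq_add (hf : HasRNDeriv ν f h) (s t : ℝ) : f t = f s + ∫ x in s..t, h x ∂ν := by
  rw [← hf.sub_eq s t]; ring

theorem norm_sub_le (hf : HasRNDeriv ν f h) {s t : ℝ} (hst : s ≤ t) :
    ‖f t - f s‖ ≤ ∫ x in s..t, ‖h x‖ ∂ν := by
  rw [hf.sub_eq]
  exact intervalIntegral.norm_integral_le_integral_norm hst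

theorem exists_bound (hf : HasRNDeriv ν f h) (s t : ℝ) :
    ∃ B, ∀ x ∈ Icc s t, ‖f x‖ ≤ B := by
  refine ⟨‖f s‖ + ∫ x in s..t, ‖h x‖ ∂ν, fun x hx => ?_⟩
  have hst : s ≤ t := hx.1.trans hx.2
  have h1 := hf.norm_sub_le hx.1
  have h2 : (∫ x in s..x, ‖h x‖ ∂ν) ≤ ∫ x in s..t, ‖h x‖ ∂ν :=
    intervalIntegral.integral_mono_interval le_rfl hx.1 hx.2
      (ae_of_all _ fun y => norm_nonneg _) (hf.intervalIntegrable s t).norm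
  have h3 : ‖f x‖ ≤ ‖f s‖ + ‖f x - f s‖ := by
    simpa using norm_add_le (f s) (f x - f s)
  linarith

theorem measurable [SFinite ν] (hf : HasRNDeriv ν f h) : Measurable f := by
  obtain ⟨c, hc⟩ := hf.2
  have hae : AEStronglyMeasurable h ν := hf.1.aestronglyMeasurable
  set g := hae.mk h with hg
  have hgm : StronglyMeasurable g := hae.stronglyMeasurable_mk
  have hgh : h =ᵐ[ν] g := hae.ae_eq_mk
  have m : ∀ S : Set (ℝ × ℝ), MeasurableSet S →
      Measurable fun t => ∫ x, S.indicator (fun z : ℝ × ℝ => g z.2) (t, x) ∂ν := by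
    intro S hS
    have h1 : StronglyMeasurable (S.indicator fun z : ℝ × ℝ => g z.2) :=
      (hgm.comp_measurable measurable_snd).indicator hS
    exact (StronglyMeasurable.integral_prod_right (ν := ν)
      (f := fun t x => S.indicator (fun z : ℝ × ℝ => g z.2) (t, x)) h1).measurable
  have m1 := m {z | c < z.2 ∧ z.2 ≤ z.1} (MeasurableSet.inter
    (measurableSet_lt measurable_const measurable_snd)
    (measurableSet_le measurable_snd measurable_fst))
  have m2 := m {z | z.1 < z.2 ∧ z.2 ≤ c} (MeasurableSet.inter
    (measurableSet_lt measurable_fst measurable_snd)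
    (measurableSet_le measurable_snd measurable_const))
  have : f = fun t => f c + ((∫ x, {z : ℝ × ℝ | c < z.2 ∧ z.2 ≤ z.1}.indicator
      (fun z : ℝ × ℝ => g z.2) (t, x) ∂ν) - ∫ x, {z : ℝ × ℝ | z.1 < z.2 ∧ z.2 ≤ c}.indicator
      (fun z : ℝ × ℝ => g z.2) (t, x) ∂ν) := by
    funext t
    rw [hc t, intervalIntegral, ← integral_indicator measurableSet_Ioc,
      ← integral_indicator measurableSet_Ioc]
    congr 2
    · refine integral_congr_ae ?_
      filter_upwards [hgh] with x hx
      simp [indicator, hx]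
    · refine integral_congr_ae ?_
      filter_upwards [hgh] with x hx
      simp [indicator, hx]
  rw [this]
  exact measurable_const.add (m1.sub m2)

theorem continuous (hf : HasRNDeriv volume f h) : Continuous f := by
  obtain ⟨c, hc⟩ := hf.2
  rw [funext hc]
  exact continuous_const.add
    (intervalIntegral.continuous_primitive (fun a b => hf.intervalIntegrable a b) c)

/-- Integration by parts for globally defined primitives. -/
theorem mul_sub_mul {θ : Measure ℝ} [SFinite θ] {G g : ℝ → 𝕜} (hf : HasRNDeriv volume f h)
    (hG : HasRNDeriv θ G g) {s t : ℝ} (hst : s ≤ t) :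
    IntervalIntegrable (fun r => h r * G r) volume s t ∧
    IntervalIntegrable (fun r => f r * g r) θ s t ∧
    f t * G t - f s * G s = (∫ r in s..t, h r * G r) + ∫ r in s..t, f r * g r ∂θ :=
  mul_sub_mul_eq_integral_add_integral hst (hf.intervalIntegrable s t) (fun x _ => hf.eq_add s x)
    (hG.intervalIntegrable s t) (fun x _ => hG.eq_add s x)

theorem of_sub_eq (hs : ∀ s t, s ≤ t →
    IntervalIntegrable h ν s t ∧ f t - f s = ∫ x in s..t, h x ∂ν) :
    HasRNDeriv ν f h := by
  refine ⟨locallyIntegrable_of_intervalIntegrable fun s t hst => (hs s t hst).1, 0, fun t => ?_⟩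
  rcases le_total 0 t with ht | ht
  · rw [← (hs 0 t ht).2]; ring
  · rw [intervalIntegral.integral_symm, ← (hs t 0 ht).2]; ring

theorem mul {G g : ℝ → 𝕜} (hf : HasRNDeriv volume f h) (hG : HasRNDeriv volume G g) :
    HasRNDeriv volume (fun r => f r * G r) (fun r => h r * G r + f r * g r) := by
  refine of_sub_eq fun s t hst => ?_
  obtain ⟨i1, i2, e⟩ := hf.mul_sub_mul hG hst
  exact ⟨i1.add i2, by rw [e, intervalIntegral.integral_add i1 i2]⟩

theorem comp_add_right (hf : HasRNDeriv ν f h) (p : ℝ) :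
    HasRNDeriv (translateMeasure ν p) (fun t => f (t + p)) (fun t => h (t + p)) := by
  refine of_sub_eq fun s t hst => ⟨?_, ?_⟩
  · rw [intervalIntegrable_translateMeasure]
    exact hf.intervalIntegrable _ _
  · rw [intervalIntegral_translateMeasure, hf.sub_eq]

end HasRNDeriv

/-! ### Growth of solutions -/

/-- The coefficients `(q, θ, h)` of the first order system `u' = q v`, `dv = h u dθ`, with
`0 ≤ q ≤ A`, `‖h‖ ≤ 1` and `θ((t, t + 1]) ≤ N`. -/
structure IsSystem {𝕜 : Type*} [RCLike 𝕜] (A N : ℝ) (q : ℝ → ℝ) (θ : Measure ℝ) (h : ℝ → 𝕜) :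
    Prop where
  q_measurable : Measurable q
  q_nonneg : ∀ t, 0 ≤ q t
  q_le : ∀ t, q t ≤ A
  h_measurable : Measurable h
  h_le : ∀ t, ‖h t‖ ≤ 1
  N_nonneg : 0 ≤ N
  measure_le : ∀ t, θ (Ioc t (t + 1)) ≤ ENNReal.ofReal N

/-- `(u, v)` solves the system `u' = q v`, `dv = h u dθ` on `ℝ`. -/
def IsSolution {𝕜 : Type*} [RCLike 𝕜] (q : ℝ → ℝ) (θ : Measure ℝ) (h u v : ℝ → 𝕜) : Prop :=
  HasRNDeriv volume u (fun t => (q t : 𝕜) * v t) ∧ HasRNDeriv θ v (fun t => h t * u t)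

theorem measure_Ioc_le_of_unit {θ : Measure ℝ} {N : ℝ} (hN : 0 ≤ N)
    (h : ∀ t, θ (Ioc t (t + 1)) ≤ ENNReal.ofReal N) {s t : ℝ} (hst : s ≤ t) :
    θ (Ioc s t) ≤ ENNReal.ofReal (N * (t - s + 1)) := by
  have key : ∀ n : ℕ, θ (Ioc s (s + n)) ≤ ENNReal.ofReal (N * n) := by
    intro n
    induction n with
    | zero => simp
    | succ n ih =>
      have : Ioc s (s + (n + 1 : ℕ)) ⊆ Ioc s (s + n) ∪ Ioc (s + n) (s + n + 1) := by
        intro x hx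
        rcases le_or_gt x (s + n) with h1 | h1
        · exact Or.inl ⟨hx.1, h1⟩
        · exact Or.inr ⟨h1, by have := hx.2; push_cast at this; linarith⟩
      calc θ (Ioc s (s + (n + 1 : ℕ))) ≤ θ (Ioc s (s + n)) + θ (Ioc (s + n) (s + n + 1)) :=
            (measure_mono this).trans (measure_union_le _ _)
        _ ≤ ENNReal.ofReal (N * n) + ENNReal.ofReal N := add_le_add ih (h _)
        _ = ENNReal.ofReal (N * (n + 1 : ℕ)) := by
            rw [← ENNReal.ofReal_add (by positivity) hN]; push_cast; ring_nf
  have h1 : t ≤ s + (⌈t - s⌉₊ : ℝ) := by linarith [Nat.le_ceil (t - s)]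
  have h2 : (⌈t - s⌉₊ : ℝ) ≤ t - s + 1 := (Nat.ceil_lt_add_one (by linarith)).le
  calc θ (Ioc s t) ≤ θ (Ioc s (s + (⌈t - s⌉₊ : ℝ))) := measure_mono (Ioc_subset_Ioc_right h1)
    _ ≤ ENNReal.ofReal (N * ⌈t - s⌉₊) := key _
    _ ≤ _ := ENNReal.ofReal_le_ofReal (mul_le_mul_of_nonneg_left h2 hN)

/-- Primitives over the intervals `(s, t]` are right-continuous. -/
theorem HasRNDeriv.continuousWithinAt_Ioi {𝕜 : Type*} [RCLike 𝕜] {ν : Measure ℝ} {f h : ℝ → 𝕜}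
    (hf : HasRNDeriv ν f h) (x : ℝ) : ContinuousWithinAt f (Ioi x) x := by
  have hint : IntegrableOn h (Ioc x (x + 1)) ν := (hf.intervalIntegrable x (x + 1)).1
  have key : Tendsto (fun y => ∫ z, (Ioc x y).indicator ((Ioc x (x + 1)).indicator h) z ∂ν)
      (𝓝[>] x) (𝓝 (∫ _, (0 : 𝕜) ∂ν)) := by
    refine tendsto_integral_filter_of_dominated_convergence
      (fun z => ‖(Ioc x (x + 1)).indicator h z‖) ?_ ?_ ?_ ?_
    · exact Eventually.of_forall fun y =>
        ((integrable_indicator_iff measurableSet_Ioc).2 hint).aestronglyMeasurable.indicator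
          measurableSet_Ioc
    · exact Eventually.of_forall fun y => ae_of_all _ fun z => norm_indicator_le_norm_self _ _
    · exact ((integrable_indicator_iff measurableSet_Ioc).2 hint).norm
    · refine ae_of_all _ fun z => ?_
      refine tendsto_const_nhds.congr' ?_
      rcases le_or_gt z x with hz | hz
      · exact Eventually.of_forall fun y => by
          exact (indicator_of_notMem (fun h' => absurd h'.1 (not_lt.2 hz)) _).symm
      · filter_upwards [Ioo_mem_nhdsGT hz] with y hy
        exact (indicator_of_notMem (fun h' => absurd h'.2 (not_le.2 hy.2)) _).symm
  rw [integral_zero] at key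
  have h2 : Tendsto (fun y => f x + ∫ z, (Ioc x y).indicator ((Ioc x (x + 1)).indicator h) z ∂ν)
      (𝓝[>] x) (𝓝 (f x)) := by simpa using tendsto_const_nhds.add key
  refine h2.congr' ?_
  filter_upwards [Ioo_mem_nhdsGT (show x < x + 1 by linarith)] with y hy
  rw [hf.eq_add x y, integral_indicator measurableSet_Ioc,
    intervalIntegral.integral_of_le hy.1.le]
  congr 1
  refine setIntegral_congr_fun measurableSet_Ioc fun z hz => ?_
  exact indicator_of_mem (show z ∈ Ioc x (x + 1) from ⟨hz.1, hz.2.trans hy.2.le⟩) _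

/-- The fundamental theorem of calculus for `φ ∘ U`, where `U` is a primitive of a right-continuous
function `W` and thus differentiable from the right everywhere. -/
theorem sub_eq_integral_comp {U W φ φ' : ℝ → ℝ} {s t : ℝ} (hst : s ≤ t)
    (hU : HasRNDeriv volume U W) (hW : Measurable W)
    (hWc : ∀ x, ContinuousWithinAt W (Ioi x) x)
    (hφ : ∀ x ∈ Icc s t, HasDerivAt φ (φ' (U x)) (U x))
    (hφ' : ContinuousOn (fun x => φ' (U x)) (Icc s t)) :
    IntervalIntegrable (fun x => φ' (U x) * W x) volume s t ∧
    φ (U t) - φ (U s) = ∫ x in s..t, φ' (U x) * W x := by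
  have hi : IntervalIntegrable (fun x => φ' (U x) * W x) volume s t :=
    (hU.intervalIntegrable s t).continuousOn_mul (by rwa [uIcc_of_le hst])
  have hd : ∀ x, HasDerivWithinAt U (W x) (Ioi x) x := by
    intro x
    have h1 := (intervalIntegral.integral_hasDerivWithinAt_right (hU.intervalIntegrable 0 x)
      (s := Ici x) (t := Ioi x) hW.stronglyMeasurable.stronglyMeasurableAtFilter (hWc x)).const_add
      (U 0)
    rw [← show U = fun t => U 0 + ∫ r in (0 : ℝ)..t, W r from funext fun t => hU.eq_add 0 t] at h1
    exact h1.mono Ioi_subset_Ici_self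
  refine ⟨hi, (intervalIntegral.integral_eq_sub_of_hasDeriv_right (f := fun x => φ (U x))
    ?_ ?_ hi).symm⟩
  · rw [uIcc_of_le hst]
    intro x hx
    exact (ContinuousAt.comp (f := U) (hφ x hx).continuousAt
      hU.continuous.continuousAt).continuousWithinAt
  · intro x hx
    rw [min_eq_left hst, max_eq_right hst] at hx
    exact (hφ x ⟨hx.1.le, hx.2.le⟩).comp_hasDerivWithinAt x (hd x)

/-- The Riccati estimate for the majorants `V = e + ∫ g dθ`, `U = e + A ∫ V` of a solution. The
quotient `r = V / U` satisfies `dr ≤ dθ - A r² dt`, so that `A r ≤ κ / 2 + A² r² / (2 κ)` bounds the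
logarithmic derivative `A r` of `U` on average by `κ`, whatever the distribution of the mass of `θ`
within unit intervals. -/
theorem log_majorant_le {θ : Measure ℝ} [IsLocallyFiniteMeasure θ] {A N κ e s t : ℝ}
    (hA : 0 < A) (hκ : 0 < κ) (hAN : A * N ≤ κ ^ 2) (hN : 0 ≤ N)
    (hθ : ∀ t, θ (Ioc t (t + 1)) ≤ ENNReal.ofReal N) (he : 0 < e) (hst : s ≤ t) {g U V : ℝ → ℝ}
    (hV : HasRNDeriv θ V g) (hU : HasRNDeriv volume U (fun x => A * V x))
    (hVs : V s = e) (hUs : U s = e) (g0 : ∀ x, 0 ≤ g x) (gU : ∀ x ∈ Icc s t, g x ≤ U x) :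
    0 < U t ∧ 0 ≤ V t ∧ Real.log (U t) + A / (2 * κ) * (V t / U t) ≤
      Real.log e + (A / (2 * κ) + κ / 2 + κ * (t - s)) := by
  have hVmono : ∀ x y, x ≤ y → V x ≤ V y := by
    intro x y hxy
    have := hV.sub_eq x y
    have h2 : 0 ≤ ∫ r in x..y, g r ∂θ := intervalIntegral.integral_nonneg hxy fun r _ => g0 r
    linarith
  have hVe : ∀ x, s ≤ x → e ≤ V x := fun x hx => hVs ▸ hVmono s x hx
  have hUe : ∀ x, s ≤ x → e ≤ U x := by
    intro x hx
    have h1 := hU.sub_eq s x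
    have h2 : 0 ≤ ∫ r in s..x, A * V r := intervalIntegral.integral_nonneg hx fun r hr =>
      mul_nonneg hA.le (he.le.trans (hVe r hr.1))
    linarith
  have hVm : Measurable V := hV.measurable
  have hVc := hV.continuousWithinAt_Ioi
  have hU0 : ∀ x ∈ Icc s t, U x ≠ 0 := fun x hx => (he.trans_le (hUe x hx.1)).ne'
  have hUc : ContinuousOn U (Icc s t) := hU.continuous.continuousOn
  have hWm : Measurable fun x => A * V x := hVm.const_mul A
  have hWc : ∀ x, ContinuousWithinAt (fun x => A * V x) (Ioi x) x := fun x =>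
    continuousWithinAt_const.mul (hVc x)
  obtain ⟨il, el⟩ := sub_eq_integral_comp (φ := Real.log) (φ' := fun y => y⁻¹) hst hU hWm hWc
    (fun x hx => Real.hasDerivAt_log (hU0 x hx)) (hUc.inv₀ hU0)
  have hinv : ∀ x ∈ Icc s t,
      IntervalIntegrable (fun x => -(U x ^ 2)⁻¹ * (A * V x)) volume s x ∧
      (U x)⁻¹ - (U s)⁻¹ = ∫ x in s..x, -(U x ^ 2)⁻¹ * (A * V x) := by
    intro x hx
    have hsub : Icc s x ⊆ Icc s t := Icc_subset_Icc_right hx.2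
    exact sub_eq_integral_comp (φ := fun y => y⁻¹) (φ' := fun y => -(y ^ 2)⁻¹) hx.1 hU hWm hWc
      (fun y hy => hasDerivAt_inv (hU0 y (hsub hy)))
      (((hUc.mono hsub).pow 2).inv₀ fun y hy => pow_ne_zero 2 (hU0 y (hsub hy))).neg
  obtain ⟨j1, j2, ej⟩ := mul_sub_mul_eq_integral_add_integral (𝕜 := ℝ) (F := fun x => (U x)⁻¹) hst
    (hinv t ⟨hst, le_rfl⟩).1 (fun x hx => by rw [← (hinv x hx).2]; ring)
    (hV.intervalIntegrable s t) (fun x _ => hV.eq_add s x)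
  have hθt : (∫ x in s..t, (U x)⁻¹ * g x ∂θ) ≤ N * (t - s + 1) := by
    have hfin : θ (Ioc s t) ≤ ENNReal.ofReal (N * (t - s + 1)) := measure_Ioc_le_of_unit hN hθ hst
    calc (∫ x in s..t, (U x)⁻¹ * g x ∂θ) ≤ ∫ x in s..t, (1 : ℝ) ∂θ := by
          refine intervalIntegral.integral_mono_on hst j2 intervalIntegrable_const fun x hx => ?_
          have hp := he.trans_le (hUe x hx.1)
          rw [inv_mul_le_iff₀ hp, mul_one]
          exact gU x hx
      _ = (θ (Ioc s t)).toReal := by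
          rw [intervalIntegral.integral_of_le hst]; simp [Measure.real]
      _ ≤ _ := ENNReal.toReal_le_of_le_ofReal (by
          have : 0 ≤ t - s := by linarith
          positivity) hfin
  have hmono : (∫ x in s..t, (U x)⁻¹ * (A * V x)) ≤
      ∫ x in s..t, (κ / 2 - A / (2 * κ) * (-(U x ^ 2)⁻¹ * (A * V x) * V x)) := by
    refine intervalIntegral.integral_mono_on hst il
      (intervalIntegrable_const.sub (j1.const_mul _)) fun x hx => ?_
    have hp := he.trans_le (hUe x hx.1)
    have : κ / 2 - A / (2 * κ) * (-(U x ^ 2)⁻¹ * (A * V x) * V x) - (U x)⁻¹ * (A * V x)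
        = (κ - A * V x / U x) ^ 2 / (2 * κ) := by
      field_simp
      ring
    have h2 : 0 ≤ (κ - A * V x / U x) ^ 2 / (2 * κ) := by positivity
    linarith
  rw [intervalIntegral.integral_sub intervalIntegrable_const (j1.const_mul _),
    intervalIntegral.integral_const_mul, intervalIntegral.integral_const, smul_eq_mul] at hmono
  have hUt := he.trans_le (hUe t hst)
  refine ⟨hUt, he.le.trans (hVe t hst), ?_⟩
  rw [hUs] at el
  rw [hUs, hVs, inv_mul_cancel₀ he.ne'] at ej
  have hα : 0 < A / (2 * κ) := by positivity
  have hαN : A / (2 * κ) * N ≤ κ / 2 := by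
    rw [div_mul_eq_mul_div, div_le_div_iff₀ (by positivity) two_pos]
    nlinarith
  have h3 : -(∫ r in s..t, -(U r ^ 2)⁻¹ * (A * V r) * V r) ≤
      1 - (U t)⁻¹ * V t + N * (t - s + 1) := by linarith
  have h4 := mul_le_mul_of_nonneg_left h3 hα.le
  have h5 : A / (2 * κ) * N * (t - s + 1) ≤ κ / 2 * (t - s + 1) :=
    mul_le_mul_of_nonneg_right hαN (by linarith)
  rw [div_eq_mul_inv (V t), mul_comm (V t)]
  nlinarith

section Growth

variable {𝕜 : Type*} [RCLike 𝕜]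

/-- The strict inequality makes room for positive majorants, also of the trivial solution. -/
theorem IsSystem.norm_solution_le_of_lt {A N κ : ℝ} (hA : 0 < A) (hκ : 0 < κ)
    (hAN : A * N ≤ κ ^ 2) {q : ℝ → ℝ} {θ : Measure ℝ} [IsLocallyFiniteMeasure θ] {h u v : ℝ → 𝕜}
    (hS : IsSystem A N q θ h) (huv : IsSolution q θ h u v) {s t e : ℝ} (hst : s ≤ t)
    (he : ‖u s‖ + ‖v s‖ < e) :
    ‖u t‖ + ‖v t‖ ≤ (1 + 2 * κ / A) * Real.exp (A / (2 * κ) + κ / 2) *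
      Real.exp (κ * (t - s)) * e := by
  obtain ⟨hu, hv⟩ := huv
  have huc := hu.continuous
  have he0 : 0 < e := (add_nonneg (norm_nonneg _) (norm_nonneg _)).trans_lt he
  set V : ℝ → ℝ := fun x => e + ∫ y in s..x, ‖u y‖ ∂θ with hVdef
  have hV : HasRNDeriv θ V fun y => ‖u y‖ :=
    ⟨huc.norm.locallyIntegrable, s, fun t => by simp [hVdef]⟩
  have hVmono : Monotone V := by
    intro x y hxy
    have := hV.sub_eq x y
    have h2 : 0 ≤ ∫ r in x..y, ‖u r‖ ∂θ :=
      intervalIntegral.integral_nonneg hxy fun r _ => norm_nonneg _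
    linarith
  set U : ℝ → ℝ := fun x => e + ∫ y in s..x, A * V y with hUdef
  have hU : HasRNDeriv volume U fun y => A * V y :=
    ⟨locallyIntegrable_of_intervalIntegrable fun a b _ => hVmono.intervalIntegrable.const_mul A,
      s, fun t => by simp [hUdef]⟩
  have hvV : ∀ x, s ≤ x → ‖v x‖ ≤ V x := by
    intro x hx
    have h1 := hv.norm_sub_le hx
    have h2 : (∫ y in s..x, ‖h y * u y‖ ∂θ) ≤ ∫ y in s..x, ‖u y‖ ∂θ := by
      refine intervalIntegral.integral_mono_on hx (hv.intervalIntegrable s x).norm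
        (hV.intervalIntegrable s x) fun y _ => ?_
      rw [norm_mul]
      exact mul_le_of_le_one_left (norm_nonneg _) (hS.h_le y)
    have h3 : ‖v x‖ ≤ ‖v s‖ + ‖v x - v s‖ := by simpa using norm_add_le (v s) (v x - v s)
    have h4 : 0 ≤ ‖u s‖ := norm_nonneg _
    simp only [hVdef]
    linarith
  have huU : ∀ x, s ≤ x → ‖u x‖ ≤ U x := by
    intro x hx
    have h1 := hu.norm_sub_le hx
    have h2 : (∫ y in s..x, ‖(q y : 𝕜) * v y‖) ≤ ∫ y in s..x, A * V y := by
      refine intervalIntegral.integral_mono_on hx (hu.intervalIntegrable s x).norm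
        (hU.intervalIntegrable s x) fun y hy => ?_
      rw [norm_mul, RCLike.norm_ofReal, abs_of_nonneg (hS.q_nonneg y)]
      exact mul_le_mul (hS.q_le y) (hvV y hy.1) (norm_nonneg _) hA.le
    have h3 : ‖u x‖ ≤ ‖u s‖ + ‖u x - u s‖ := by simpa using norm_add_le (u s) (u x - u s)
    have h4 : 0 ≤ ‖v s‖ := norm_nonneg _
    simp only [hUdef]
    linarith
  obtain ⟨hUt, hVt, hlog⟩ := log_majorant_le hA hκ hAN hS.N_nonneg hS.measure_le he0 hst hV hU
    (by simp [hVdef]) (by simp [hUdef]) (fun x => norm_nonneg _) fun x hx => huU x hx.1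
  set α := A / (2 * κ) with hα
  have hα0 : 0 < α := by positivity
  set r := V t / U t with hr
  have hr0 : 0 ≤ r := by positivity
  have hexp := Real.exp_le_exp.2 hlog
  rw [Real.exp_add, Real.exp_add, Real.exp_log hUt, Real.exp_log he0, Real.exp_add] at hexp
  set T := Real.exp (α + κ / 2) * Real.exp (κ * (t - s)) with hT
  have h1 : U t ≤ e * T := by
    refine le_trans ?_ hexp
    exact le_mul_of_one_le_right hUt.le (Real.one_le_exp (by positivity))
  have h2 : α * V t ≤ e * T := by
    refine le_trans ?_ hexp
    have : α * V t = U t * (α * r) := by rw [hr]; field_simp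
    rw [this]
    exact mul_le_mul_of_nonneg_left (by linarith [Real.add_one_le_exp (α * r)]) hUt.le
  have h3 : V t ≤ 2 * κ / A * (e * T) := by
    have : 2 * κ / A = α⁻¹ := by rw [hα, inv_div]
    rw [this, ← div_eq_inv_mul, le_div_iff₀ hα0]
    linarith
  calc ‖u t‖ + ‖v t‖ ≤ U t + V t := add_le_add (huU t hst) (hvV t hst)
    _ ≤ e * T + 2 * κ / A * (e * T) := add_le_add h1 h3
    _ = _ := by rw [hT]; ring

/-- Exponential growth forwards in time, with a constant that depends on `A` and `κ` only. -/
theorem IsSystem.norm_solution_le {A N κ : ℝ} (hA : 0 < A) (hκ : 0 < κ)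
    (hAN : A * N ≤ κ ^ 2) {q : ℝ → ℝ} {θ : Measure ℝ} [IsLocallyFiniteMeasure θ] {h u v : ℝ → 𝕜}
    (hS : IsSystem A N q θ h) (huv : IsSolution q θ h u v) {s t : ℝ} (hst : s ≤ t) :
    ‖u t‖ + ‖v t‖ ≤ (1 + 2 * κ / A) * Real.exp (A / (2 * κ) + κ / 2) *
      Real.exp (κ * (t - s)) * (‖u s‖ + ‖v s‖) := by
  set c := (1 + 2 * κ / A) * Real.exp (A / (2 * κ) + κ / 2) * Real.exp (κ * (t - s)) with hc
  have hc0 : 0 < c := by positivity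
  rw [← div_le_iff₀' hc0]
  refine le_of_forall_gt_imp_ge_of_dense fun e he => ?_
  rw [div_le_iff₀' hc0]
  exact hS.norm_solution_le_of_lt hA hκ hAN huv hst he

end Growth

/-! ### Existence of solutions and the Wronskian -/

section Existence

variable {𝕜 : Type*} [RCLike 𝕜]

theorem intervalIntegrable_of_bounded {f : ℝ → 𝕜} (hf : Measurable f) {s t : ℝ} (hst : s ≤ t)
    (hb : ∃ B, ∀ x ∈ Icc s t, ‖f x‖ ≤ B) : IntervalIntegrable f volume s t := by
  obtain ⟨B, hB⟩ := hb
  rw [intervalIntegrable_iff_integrableOn_Ioc_of_le hst]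
  exact Measure.integrableOn_of_bounded (M := B) (by simp) hf.aestronglyMeasurable
    ((ae_restrict_iff' measurableSet_Ioc).2 (ae_of_all _ fun x hx => hB x ⟨hx.1.le, hx.2⟩))

/-- The second component `v₀ + ∫_c^t h u dθ` of the Picard iteration. -/
noncomputable def picardMomentum (θ : Measure ℝ) (h : ℝ → 𝕜) (c : ℝ) (v₀ : 𝕜) (u : ℝ → 𝕜)
    (t : ℝ) : 𝕜 :=
  v₀ + ∫ x in c..t, h x * u x ∂θ

/-- The first component `u₀ + ∫_c^t q v` of the Picard iteration. -/
noncomputable def picardPosition (q : ℝ → ℝ) (θ : Measure ℝ) (h : ℝ → 𝕜) (c : ℝ) (u₀ v₀ : 𝕜)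
    (u : ℝ → 𝕜) (t : ℝ) : 𝕜 :=
  u₀ + ∫ x in c..t, (q x : 𝕜) * picardMomentum θ h c v₀ u x

theorem integral_exp_sq_mul {l : ℝ} (hl : 0 < l) {y : ℝ} :
    ∫ x in (0 : ℝ)..y, Real.exp (l / 2 * (x + 1) ^ 2) * (x + 1) =
      (Real.exp (l / 2 * (y + 1) ^ 2) - Real.exp (l / 2)) / l := by
  have hd : ∀ x ∈ uIcc 0 y, HasDerivAt (fun x : ℝ => Real.exp (l / 2 * (x + 1) ^ 2) / l)
      (Real.exp (l / 2 * (x + 1) ^ 2) * (x + 1)) x := by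
    intro x _
    have h1 : HasDerivAt (fun x : ℝ => l / 2 * (x + 1) ^ 2) (l * (x + 1)) x := by
      have := (((hasDerivAt_id x).add_const 1).pow 2).const_mul (l / 2)
      refine this.congr_deriv ?_
      simp; ring
    refine (h1.exp.div_const l).congr_deriv ?_
    field_simp
  rw [intervalIntegral.integral_eq_sub_of_hasDerivAt hd (by
    apply Continuous.intervalIntegrable; fun_prop)]
  simp; ring

namespace IsSystem

variable {A N : ℝ} {q : ℝ → ℝ} {θ : Measure ℝ} {h : ℝ → 𝕜}

theorem norm_integral_le_of_norm_le (hS : IsSystem A N q θ h) {c t M : ℝ}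
    {d : ℝ → 𝕜} (hM : ∀ x ∈ uIcc c t, ‖d x‖ ≤ M) :
    ‖∫ x in c..t, h x * d x ∂θ‖ ≤ M * (N * (|t - c| + 1)) := by
  have hM0 : 0 ≤ M := (norm_nonneg _).trans (hM c left_mem_uIcc)
  have hθ : θ (uIoc c t) ≤ ENNReal.ofReal (N * (|t - c| + 1)) := by
    have h1 := measure_Ioc_le_of_unit hS.N_nonneg hS.measure_le (min_le_max (a := c) (b := t))
    rwa [max_sub_min_eq_abs' , abs_sub_comm] at h1
  have hN := hS.N_nonneg
  calc ‖∫ x in c..t, h x * d x ∂θ‖ = ‖∫ x in uIoc c t, h x * d x ∂θ‖ :=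
        intervalIntegral.norm_intervalIntegral_eq _ _ _ _
    _ ≤ M * (θ.real (uIoc c t)) := by
        refine norm_setIntegral_le_of_norm_le_const (hθ.trans_lt ENNReal.ofReal_lt_top)
          fun x hx => ?_
        rw [norm_mul]
        exact (mul_le_of_le_one_left (norm_nonneg _) (hS.h_le x)).trans
          (hM x (uIoc_subset_uIcc hx))
    _ ≤ _ := by
        refine mul_le_mul_of_nonneg_left ?_ hM0
        exact ENNReal.toReal_le_of_le_ofReal (by positivity) hθ

variable [IsLocallyFiniteMeasure θ]

theorem hasRNDeriv_picardMomentum (hS : IsSystem A N q θ h) (c : ℝ) (v₀ : 𝕜) {u : ℝ → 𝕜}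
    (hu : Continuous u) :
    HasRNDeriv θ (picardMomentum θ h c v₀ u) (fun x => h x * u x) := by
  refine ⟨hu.locallyIntegrable.mono
    (hS.h_measurable.aestronglyMeasurable.mul hu.aestronglyMeasurable)
    (ae_of_all _ fun x => ?_), c, fun t => by simp [picardMomentum]⟩
  rw [norm_mul]
  exact mul_le_of_le_one_left (norm_nonneg _) (hS.h_le x)

theorem hasRNDeriv_picardPosition (hS : IsSystem A N q θ h) (c : ℝ) (u₀ v₀ : 𝕜) {u : ℝ → 𝕜}
    (hu : Continuous u) :
    HasRNDeriv volume (picardPosition q θ h c u₀ v₀ u)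
      (fun x => (q x : 𝕜) * picardMomentum θ h c v₀ u x) := by
  have hV := hS.hasRNDeriv_picardMomentum c v₀ hu
  refine ⟨locallyIntegrable_of_intervalIntegrable fun s t hst => ?_, c,
    fun t => by simp [picardPosition]⟩
  refine intervalIntegrable_of_bounded
    ((RCLike.measurable_ofReal.comp hS.q_measurable).mul hV.measurable) hst ?_
  obtain ⟨B, hB⟩ := hV.exists_bound s t
  refine ⟨A * B, fun x hx => ?_⟩
  change ‖(q x : 𝕜) * picardMomentum θ h c v₀ u x‖ ≤ A * B
  rw [norm_mul, RCLike.norm_ofReal, abs_of_nonneg (hS.q_nonneg x)]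
  exact mul_le_mul (hS.q_le x) (hB x hx) (norm_nonneg _) ((hS.q_nonneg x).trans (hS.q_le x))

/-- The Picard map is a contraction for the weight `exp (l (|t - c| + 1)² / 2)`: the factor
`|t - c| + 1` from `θ((c, t]) ≤ N (|t - c| + 1)` is absorbed by the derivative of the weight. -/
theorem norm_picardPosition_sub_le (hS : IsSystem A N q θ h) {l : ℝ} (hl : 0 < l)
    (hlAN : 2 * (A * N) ≤ l) (c : ℝ) (u₀ v₀ : 𝕜)
    {u₁ u₂ : ℝ → 𝕜} (hu₁ : Continuous u₁) (hu₂ : Continuous u₂) {D : ℝ}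
    (hD : ∀ t, ‖u₁ t - u₂ t‖ ≤ D * Real.exp (l / 2 * (|t - c| + 1) ^ 2)) (t : ℝ) :
    ‖picardPosition q θ h c u₀ v₀ u₁ t - picardPosition q θ h c u₀ v₀ u₂ t‖ ≤
      D / 2 * Real.exp (l / 2 * (|t - c| + 1) ^ 2) := by
  have hA : 0 ≤ A := (hS.q_nonneg 0).trans (hS.q_le 0)
  have hN := hS.N_nonneg
  have hD0 : 0 ≤ D := by
    have := (norm_nonneg _).trans (hD c)
    exact nonneg_of_mul_nonneg_left this (Real.exp_pos _)
  have hV₁ := hS.hasRNDeriv_picardMomentum c v₀ hu₁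
  have hV₂ := hS.hasRNDeriv_picardMomentum c v₀ hu₂
  have hP₁ := hS.hasRNDeriv_picardPosition c u₀ v₀ hu₁
  have hP₂ := hS.hasRNDeriv_picardPosition c u₀ v₀ hu₂
  have hVd : ∀ x, ‖picardMomentum θ h c v₀ u₁ x - picardMomentum θ h c v₀ u₂ x‖ ≤
      D * Real.exp (l / 2 * (|x - c| + 1) ^ 2) * (N * (|x - c| + 1)) := by
    intro x
    have : picardMomentum θ h c v₀ u₁ x - picardMomentum θ h c v₀ u₂ x =
        ∫ y in c..x, h y * (u₁ y - u₂ y) ∂θ := by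
      simp only [picardMomentum, mul_sub]
      rw [intervalIntegral.integral_sub (hV₁.intervalIntegrable _ _) (hV₂.intervalIntegrable _ _)]
      ring
    rw [this]
    refine hS.norm_integral_le_of_norm_le fun y hy => (hD y).trans ?_
    have : |y - c| ≤ |x - c| := by
      have := abs_sub_left_of_mem_uIcc hy
      simpa using this
    gcongr
  have hPd : picardPosition q θ h c u₀ v₀ u₁ t - picardPosition q θ h c u₀ v₀ u₂ t =
      ∫ x in c..t, (q x : 𝕜) * (picardMomentum θ h c v₀ u₁ x - picardMomentum θ h c v₀ u₂ x) := by
    simp only [picardPosition, mul_sub]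
    rw [intervalIntegral.integral_sub (hP₁.intervalIntegrable _ _) (hP₂.intervalIntegrable _ _)]
    ring
  set w : ℝ → ℝ := fun y => Real.exp (l / 2 * (y + 1) ^ 2) * (y + 1) with hw
  have hwc : Continuous w := by fun_prop
  have hb : ∀ x, ‖(q x : 𝕜) * (picardMomentum θ h c v₀ u₁ x - picardMomentum θ h c v₀ u₂ x)‖ ≤
      A * N * D * w |x - c| := by
    intro x
    rw [norm_mul, RCLike.norm_ofReal, abs_of_nonneg (hS.q_nonneg x)]
    calc _ ≤ A * (D * Real.exp (l / 2 * (|x - c| + 1) ^ 2) * (N * (|x - c| + 1))) :=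
          mul_le_mul (hS.q_le x) (hVd x) (norm_nonneg _) hA
      _ = _ := by simp only [hw]; ring
  have hI : ‖∫ x in c..t, (q x : 𝕜) * (picardMomentum θ h c v₀ u₁ x -
      picardMomentum θ h c v₀ u₂ x)‖ ≤ A * N * D * ∫ x in (0 : ℝ)..|t - c|, w x := by
    rcases le_total c t with hct | hct
    · refine (intervalIntegral.norm_integral_le_of_norm_le hct (ae_of_all _ fun x _ => hb x)
        (by apply Continuous.intervalIntegrable; fun_prop)).trans_eq ?_
      rw [intervalIntegral.integral_const_mul]
      congr 1
      rw [abs_of_nonneg (sub_nonneg.2 hct), ← sub_self c,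
        ← intervalIntegral.integral_comp_sub_right]
      refine intervalIntegral.integral_congr fun x hx => ?_
      rw [uIcc_of_le hct] at hx
      simp only [abs_of_nonneg (sub_nonneg.2 hx.1)]
    · rw [intervalIntegral.integral_symm, norm_neg]
      refine (intervalIntegral.norm_integral_le_of_norm_le hct (ae_of_all _ fun x _ => hb x)
        (by apply Continuous.intervalIntegrable; fun_prop)).trans_eq ?_
      rw [intervalIntegral.integral_const_mul]
      congr 1
      rw [abs_of_nonpos (sub_nonpos.2 hct), neg_sub, ← sub_self c,
        ← intervalIntegral.integral_comp_sub_left]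
      refine intervalIntegral.integral_congr fun x hx => ?_
      rw [uIcc_of_le hct] at hx
      simp only [abs_of_nonpos (sub_nonpos.2 hx.2), neg_sub]
  rw [hPd]
  refine hI.trans ?_
  rw [hw, integral_exp_sq_mul hl]
  set E := Real.exp (l / 2 * (|t - c| + 1) ^ 2)
  calc A * N * D * ((E - Real.exp (l / 2)) / l) ≤ A * N * D * (E / l) := by
        have := Real.exp_pos (l / 2)
        gcongr
        linarith
    _ = D * E * (A * N / l) := by ring
    _ ≤ D * E * (1 / 2) := by
        refine mul_le_mul_of_nonneg_left ?_ (by positivity)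
        rw [div_le_div_iff₀ hl two_pos]; linarith
    _ = _ := by ring

/-- Solutions with prescribed data at `c` exist on the whole line. -/
theorem exists_solution (hS : IsSystem A N q θ h) (c : ℝ) (u₀ v₀ : 𝕜) :
    ∃ u v, IsSolution q θ h u v ∧ u c = u₀ ∧ v c = v₀ := by
  have hA : 0 ≤ A := (hS.q_nonneg 0).trans (hS.q_le 0)
  have hN := hS.N_nonneg
  set l := 2 * (A * N) + 1 with hl
  have hl0 : 0 < l := by positivity
  have hl1 : 1 ≤ l := by rw [hl]; linarith [mul_nonneg hA hN]
  set w : ℝ → ℝ := fun t => Real.exp (l / 2 * (|t - c| + 1) ^ 2) with hw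
  have hwc : Continuous w := by fun_prop
  have hw0 : ∀ t, 0 < w t := fun t => Real.exp_pos _
  have hwy : ∀ t, |t - c| + 1 ≤ w t := by
    intro t
    have h1 := Real.add_one_le_exp (l / 2 * (|t - c| + 1) ^ 2)
    have h2 : 0 ≤ |t - c| := abs_nonneg _
    have h3 : 1 / 2 * (|t - c| + 1) ^ 2 ≤ l / 2 * (|t - c| + 1) ^ 2 := by gcongr
    simp only [hw]
    nlinarith
  have hcont : ∀ f : BoundedContinuousFunction ℝ 𝕜, Continuous fun t => (w t : 𝕜) * f t :=
    fun f => (RCLike.continuous_ofReal.comp hwc).mul f.continuous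
  set P : BoundedContinuousFunction ℝ 𝕜 → ℝ → 𝕜 :=
    fun f => picardPosition q θ h c u₀ v₀ fun t => (w t : 𝕜) * f t with hP
  have hPc : ∀ f, Continuous (P f) := fun f =>
    (hS.hasRNDeriv_picardPosition c u₀ v₀ (hcont f)).continuous
  have hdiff : ∀ f g t, ‖P f t - P g t‖ ≤ dist f g / 2 * w t := by
    intro f g t
    refine hS.norm_picardPosition_sub_le hl0 (by rw [hl]; linarith) c u₀ v₀ (hcont f) (hcont g)
      (fun x => ?_) t
    rw [← mul_sub, norm_mul, RCLike.norm_ofReal, abs_of_pos (hw0 x), mul_comm]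
    refine mul_le_mul_of_nonneg_right ?_ (hw0 x).le
    rw [← dist_eq_norm]
    exact BoundedContinuousFunction.dist_coe_le_dist x
  have hP0 : ∀ t, ‖P 0 t‖ ≤ (‖u₀‖ + A * ‖v₀‖) * w t := by
    intro t
    have e : P 0 t = u₀ + ∫ x in c..t, (q x : 𝕜) * v₀ := by
      simp [hP, picardPosition, picardMomentum]
    have h1 : ‖∫ x in c..t, (q x : 𝕜) * v₀‖ ≤ A * ‖v₀‖ * |t - c| := by
      refine intervalIntegral.norm_integral_le_of_norm_le_const fun x _ => ?_
      rw [norm_mul, RCLike.norm_ofReal, abs_of_nonneg (hS.q_nonneg x)]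
      exact mul_le_mul_of_nonneg_right (hS.q_le x) (norm_nonneg _)
    rw [e]
    refine (norm_add_le _ _).trans ?_
    have h2 := hwy t
    have h3 : 0 ≤ |t - c| := abs_nonneg _
    have h4 : ‖u₀‖ * 1 ≤ ‖u₀‖ * w t := by gcongr; linarith
    have h5 : A * ‖v₀‖ * |t - c| ≤ A * ‖v₀‖ * w t := by gcongr; linarith
    linarith
  have hwinv : ∀ (x : 𝕜) t, ‖((w t)⁻¹ : ℝ) * x‖ = (w t)⁻¹ * ‖x‖ := by
    intro x t
    rw [norm_mul, RCLike.norm_ofReal, abs_of_pos (inv_pos.2 (hw0 t))]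
  have hbound : ∀ f t, ‖((w t)⁻¹ : ℝ) * P f t‖ ≤ dist f 0 / 2 + (‖u₀‖ + A * ‖v₀‖) := by
    intro f t
    rw [hwinv, inv_mul_le_iff₀ (hw0 t)]
    have h1 : ‖P f t‖ ≤ ‖P f t - P 0 t‖ + ‖P 0 t‖ := by
      simpa using norm_add_le (P f t - P 0 t) (P 0 t)
    have := hdiff f 0 t
    have := hP0 t
    linarith
  set T : BoundedContinuousFunction ℝ 𝕜 → BoundedContinuousFunction ℝ 𝕜 := fun f =>
    BoundedContinuousFunction.ofNormedAddCommGroup (fun t => (((w t)⁻¹ : ℝ) : 𝕜) * P f t)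
      ((RCLike.continuous_ofReal.comp (hwc.inv₀ fun t => (hw0 t).ne')).mul (hPc f)) _ (hbound f)
    with hT
  have hTc : ContractingWith (1 / 2) T := by
    refine ⟨by norm_num, LipschitzWith.of_dist_le_mul fun f g => ?_⟩
    rw [BoundedContinuousFunction.dist_le (by positivity)]
    intro t
    simp only [hT, BoundedContinuousFunction.coe_ofNormedAddCommGroup]
    rw [dist_eq_norm, ← mul_sub, hwinv, inv_mul_le_iff₀ (hw0 t)]
    refine (hdiff f g t).trans_eq ?_
    push_cast
    ring
  set f := hTc.fixedPoint T
  have hf : T f = f := hTc.fixedPoint_isFixedPt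
  set u : ℝ → 𝕜 := fun t => (w t : 𝕜) * f t with hu
  have hfix : picardPosition q θ h c u₀ v₀ u = u := by
    funext t
    have h1 : (((w t)⁻¹ : ℝ) : 𝕜) * P f t = f t := by
      have := congrArg (fun g => g t) hf
      simpa [hT] using this
    have h2 : (w t : 𝕜) ≠ 0 := by exact_mod_cast (hw0 t).ne'
    rw [hu]
    simp only
    rw [← h1]
    push_cast
    field_simp
    rfl
  refine ⟨u, picardMomentum θ h c v₀ u, ⟨?_, hS.hasRNDeriv_picardMomentum c v₀ (hcont f)⟩, ?_, ?_⟩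
  · have := hS.hasRNDeriv_picardPosition c u₀ v₀ (hcont f)
    rwa [← hu, hfix] at this
  · rw [← hfix]; simp [picardPosition]
  · simp [picardMomentum]

end IsSystem

theorem IsSolution.wronskian_eq {q : ℝ → ℝ} {θ : Measure ℝ} [IsLocallyFiniteMeasure θ]
    {h u₁ v₁ u₂ v₂ : ℝ → 𝕜} (h₁ : IsSolution q θ h u₁ v₁) (h₂ : IsSolution q θ h u₂ v₂) (s t : ℝ) :
    u₁ t * v₂ t - v₁ t * u₂ t = u₁ s * v₂ s - v₁ s * u₂ s := by
  wlog hst : s ≤ t generalizing s t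
  · exact (this t s (le_of_not_ge hst)).symm
  have e₁ := (h₁.1.mul_sub_mul h₂.2 hst).2.2
  have e₂ := (h₂.1.mul_sub_mul h₁.2 hst).2.2
  have i₁ : (∫ r in s..t, (q r : 𝕜) * v₁ r * v₂ r) = ∫ r in s..t, (q r : 𝕜) * v₂ r * v₁ r :=
    intervalIntegral.integral_congr fun r _ => by ring
  have i₂ : (∫ r in s..t, u₁ r * (h r * u₂ r) ∂θ) = ∫ r in s..t, u₂ r * (h r * u₁ r) ∂θ :=
    intervalIntegral.integral_congr fun r _ => by ring
  rw [i₁, i₂] at e₁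
  linear_combination e₁ - e₂

/-- The constant in the exponential bound for solutions. -/
noncomputable def growthConst (A κ : ℝ) : ℝ :=
  2 * ((1 + 2 * κ / A) * Real.exp (A / (2 * κ) + κ / 2))

theorem growthConst_pos {A κ : ℝ} (hA : 0 < A) (hκ : 0 < κ) : 0 < growthConst A κ := by
  unfold growthConst; positivity

/-- Solutions grow and decay at most exponentially with rate `κ`, where `A N ≤ κ²`. The bound
backwards in time follows from the one forwards, as the Wronskian is constant. -/
theorem IsSystem.norm_solution_le_exp {A N κ : ℝ} (hA : 0 < A) (hκ : 0 < κ)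
    (hAN : A * N ≤ κ ^ 2) {q : ℝ → ℝ} {θ : Measure ℝ} [IsLocallyFiniteMeasure θ] {h u v : ℝ → 𝕜}
    (hS : IsSystem A N q θ h) (huv : IsSolution q θ h u v) (s t : ℝ) :
    ‖u t‖ + ‖v t‖ ≤ growthConst A κ * Real.exp (κ * |t - s|) * (‖u s‖ + ‖v s‖) := by
  rcases le_total s t with hst | hst
  · rw [abs_of_nonneg (sub_nonneg.2 hst)]
    refine (hS.norm_solution_le hA hκ hAN huv hst).trans ?_
    have h1 : 0 ≤ (1 + 2 * κ / A) * Real.exp (A / (2 * κ) + κ / 2) := by positivity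
    have h2 : (1 + 2 * κ / A) * Real.exp (A / (2 * κ) + κ / 2) ≤ growthConst A κ := by
      unfold growthConst; linarith
    exact mul_le_mul_of_nonneg_right (mul_le_mul_of_nonneg_right h2 (Real.exp_pos _).le)
      (by positivity)
  · rw [abs_of_nonpos (sub_nonpos.2 hst), neg_sub]
    set c := (1 + 2 * κ / A) * Real.exp (A / (2 * κ) + κ / 2) * Real.exp (κ * (s - t)) with hc
    obtain ⟨u₁, v₁, h₁, hu₁, hv₁⟩ := hS.exists_solution t (1 : 𝕜) 0
    obtain ⟨u₂, v₂, h₂, hu₂, hv₂⟩ := hS.exists_solution t (0 : 𝕜) 1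
    have b₁ := hS.norm_solution_le hA hκ hAN h₁ hst
    have b₂ := hS.norm_solution_le hA hκ hAN h₂ hst
    rw [← hc, hu₁, hv₁] at b₁
    rw [← hc, hu₂, hv₂] at b₂
    simp only [norm_one, norm_zero, add_zero, zero_add, mul_one] at b₁ b₂
    have w₁ := h₁.wronskian_eq huv s t
    have w₂ := h₂.wronskian_eq huv s t
    rw [hu₁, hv₁] at w₁
    rw [hu₂, hv₂] at w₂
    have key : ∀ a b : 𝕜, ‖a‖ + ‖b‖ ≤ c → ‖a * v s - b * u s‖ ≤ c * (‖u s‖ + ‖v s‖) := by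
      intro a b hab
      refine (norm_sub_le _ _).trans ?_
      rw [norm_mul, norm_mul]
      nlinarith [norm_nonneg a, norm_nonneg b, norm_nonneg (u s), norm_nonneg (v s)]
    have k₁ := key _ _ b₁
    have k₂ := key _ _ b₂
    rw [← w₁] at k₁
    rw [← w₂] at k₂
    simp only [one_mul, zero_mul, sub_zero, zero_sub, norm_neg] at k₁ k₂
    have : growthConst A κ * Real.exp (κ * (s - t)) = 2 * c := by
      rw [hc, growthConst]; ring
    rw [this]
    linarith

end Existence

/-! ### Comparison of two systems -/

section Comparison

variable {𝕜 : Type*} [RCLike 𝕜]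

/-- The Wronskian of solutions `(φ, ψ)` and `(u, v)` of two systems, with `v` replaced by
`v - (G' - G) u`. The correction removes the difference of the two measures from the derivative, of
which only a Lebesgue integral of the primitive `G' - G` is left. -/
theorem corrected_wronskian_sub {q q' : ℝ → ℝ} {θ θ' : Measure ℝ} [IsLocallyFiniteMeasure θ]
    [IsLocallyFiniteMeasure θ'] {h h' φ ψ u v G G' : ℝ → 𝕜} (hφ : IsSolution q θ h φ ψ)
    (hu : IsSolution q' θ' h' u v) (hG : HasRNDeriv θ G h) (hG' : HasRNDeriv θ' G' h')
    {s t : ℝ} (hst : s ≤ t) :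
    (φ t * v t - ψ t * u t - (G' t - G t) * (φ t * u t)) -
      (φ s * v s - ψ s * u s - (G' s - G s) * (φ s * u s)) =
    ∫ r in s..t, (ψ r * v r * ((q r : 𝕜) - q' r) -
      (G' r - G r) * ((q r : 𝕜) * ψ r * u r + φ r * (q' r * v r))) := by
  obtain ⟨i₁, -, e₁⟩ := hφ.1.mul_sub_mul hu.2 hst
  obtain ⟨i₂, -, e₂⟩ := hu.1.mul_sub_mul hφ.2 hst
  obtain ⟨i₃, -, e₃⟩ := (hφ.1.mul hu.1).mul_sub_mul hG' hst
  obtain ⟨i₄, -, e₄⟩ := (hφ.1.mul hu.1).mul_sub_mul hG hst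
  have c₁ : (∫ r in s..t, φ r * (h' r * u r) ∂θ') = ∫ r in s..t, φ r * u r * h' r ∂θ' :=
    intervalIntegral.integral_congr fun r _ => by ring
  have c₂ : (∫ r in s..t, u r * (h r * φ r) ∂θ) = ∫ r in s..t, φ r * u r * h r ∂θ :=
    intervalIntegral.integral_congr fun r _ => by ring
  rw [c₁] at e₁
  rw [c₂] at e₂
  have : (∫ r in s..t, (ψ r * v r * ((q r : 𝕜) - q' r) -
      (G' r - G r) * ((q r : 𝕜) * ψ r * u r + φ r * (q' r * v r)))) =
      (((∫ r in s..t, (q r : 𝕜) * ψ r * v r) - ∫ r in s..t, (q' r : 𝕜) * v r * ψ r) -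
      ∫ r in s..t, ((q r : 𝕜) * ψ r * u r + φ r * (q' r * v r)) * G' r) +
      ∫ r in s..t, ((q r : 𝕜) * ψ r * u r + φ r * (q' r * v r)) * G r := by
    rw [← intervalIntegral.integral_sub i₁ i₂, ← intervalIntegral.integral_sub (i₁.sub i₂) i₃,
      ← intervalIntegral.integral_add ((i₁.sub i₂).sub i₃) i₄]
    exact intervalIntegral.integral_congr fun r _ => by ring
  rw [this]
  linear_combination e₁ - e₂ - e₃ + e₄

theorem norm_corrected_wronskian_sub_le {A N N' : ℝ} {q q' : ℝ → ℝ} {θ θ' : Measure ℝ}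
    [IsLocallyFiniteMeasure θ] [IsLocallyFiniteMeasure θ'] {h h' φ ψ u v G G' : ℝ → 𝕜}
    (hS : IsSystem A N q θ h) (hS' : IsSystem A N' q' θ' h')
    (hφ : IsSolution q θ h φ ψ)
    (hu : IsSolution q' θ' h' u v) (hG : HasRNDeriv θ G h) (hG' : HasRNDeriv θ' G' h')
    {s t : ℝ} (hst : s ≤ t) {B : ℝ}
    (hB : ∀ r ∈ Icc s t, (‖φ r‖ + ‖ψ r‖) * (‖u r‖ + ‖v r‖) ≤ B) :
    ‖(φ t * v t - ψ t * u t - (G' t - G t) * (φ t * u t)) -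
      (φ s * v s - ψ s * u s - (G' s - G s) * (φ s * u s))‖ ≤
    B * ((∫ r in s..t, |q r - q' r|) + A * ∫ r in s..t, ‖G' r - G r‖) := by
  have hA : 0 ≤ A := (hS.q_nonneg 0).trans (hS.q_le 0)
  rw [corrected_wronskian_sub hφ hu hG hG' hst]
  have i₁ : IntervalIntegrable (fun r => |q r - q' r|) volume s t :=
    intervalIntegrable_of_bounded (𝕜 := ℝ) (hS.q_measurable.sub hS'.q_measurable).abs hst
      ⟨A, fun x _ => by
        have h1 := hS.q_nonneg x
        have h2 := hS.q_le x
        have h3 := hS'.q_nonneg x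
        have h4 := hS'.q_le x
        change |(|q x - q' x|)| ≤ A
        rw [abs_abs, abs_le]
        constructor <;> linarith⟩
  have i₂ : IntervalIntegrable (fun r => ‖G' r - G r‖) volume s t := by
    obtain ⟨B₁, hB₁⟩ := hG'.exists_bound s t
    obtain ⟨B₂, hB₂⟩ := hG.exists_bound s t
    exact (intervalIntegrable_of_bounded (hG'.measurable.sub hG.measurable) hst
      ⟨B₁ + B₂, fun x hx => (norm_sub_le _ _).trans (add_le_add (hB₁ x hx) (hB₂ x hx))⟩).norm
  have e : B * ((∫ r in s..t, |q r - q' r|) + A * ∫ r in s..t, ‖G' r - G r‖) =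
      ∫ r in s..t, (B * |q r - q' r| + B * A * ‖G' r - G r‖) := by
    rw [intervalIntegral.integral_add (i₁.const_mul _) (i₂.const_mul _),
      intervalIntegral.integral_const_mul, intervalIntegral.integral_const_mul]
    ring
  rw [e]
  refine intervalIntegral.norm_integral_le_of_norm_le hst (ae_of_all _ fun r hr => ?_)
    ((i₁.const_mul _).add (i₂.const_mul _))
  have hBr := hB r ⟨hr.1.le, hr.2⟩
  have n1 := norm_nonneg (φ r)
  have n2 := norm_nonneg (ψ r)
  have n3 := norm_nonneg (u r)
  have n4 := norm_nonneg (v r)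
  have b₁ : ‖ψ r * v r * ((q r : 𝕜) - q' r)‖ ≤ B * |q r - q' r| := by
    rw [norm_mul, norm_mul, ← RCLike.ofReal_sub, RCLike.norm_ofReal]
    refine mul_le_mul_of_nonneg_right (le_trans ?_ hBr) (abs_nonneg _)
    nlinarith [mul_nonneg n1 n3, mul_nonneg n1 n4, mul_nonneg n2 n3]
  have b₂ : ‖(G' r - G r) * ((q r : 𝕜) * ψ r * u r + φ r * (q' r * v r))‖ ≤
      B * A * ‖G' r - G r‖ := by
    rw [norm_mul, mul_comm]
    refine mul_le_mul_of_nonneg_right ?_ (norm_nonneg _)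
    refine (norm_add_le _ _).trans ?_
    simp only [norm_mul, RCLike.norm_ofReal, abs_of_nonneg (hS.q_nonneg r),
      abs_of_nonneg (hS'.q_nonneg r)]
    have c₁ : q r * ‖ψ r‖ * ‖u r‖ ≤ A * (‖ψ r‖ * ‖u r‖) := by
      rw [mul_assoc]
      exact mul_le_mul_of_nonneg_right (hS.q_le r) (mul_nonneg n2 n3)
    have c₂ : ‖φ r‖ * (q' r * ‖v r‖) ≤ A * (‖φ r‖ * ‖v r‖) := by
      rw [mul_left_comm]
      exact mul_le_mul_of_nonneg_right (hS'.q_le r) (mul_nonneg n1 n4)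
    have c₃ : A * (‖ψ r‖ * ‖u r‖ + ‖φ r‖ * ‖v r‖) ≤ A * B := by
      refine mul_le_mul_of_nonneg_left (le_trans ?_ hBr) hA
      nlinarith [mul_nonneg n1 n3, mul_nonneg n2 n4]
    linarith
  exact (norm_sub_le _ _).trans (add_le_add b₁ b₂)

/-- Solutions of two systems that agree at `r₀` differ at `r₁` by at most `exp (κ |r₁ - r₀|)`
times the size of the perturbation. The rate `κ` appears only once, as the error made at `r` is a
product of a solution growing from `r₀` to `r` and one growing from `r₁` to `r`. -/
theorem norm_solution_sub_le {A N κ : ℝ} (hA : 0 < A) (hκ : 0 < κ) (hAN : A * N ≤ κ ^ 2)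
    {q q' : ℝ → ℝ} {θ θ' : Measure ℝ}
    [IsLocallyFiniteMeasure θ] [IsLocallyFiniteMeasure θ'] {h h' x y u v G G' : ℝ → 𝕜}
    (hS : IsSystem A N q θ h) (hS' : IsSystem A N q' θ' h')
    (hx : IsSolution q θ h x y)
    (hu : IsSolution q' θ' h' u v) (hG : HasRNDeriv θ G h) (hG' : HasRNDeriv θ' G' h')
    {r₀ r₁ δ η : ℝ} (hxu : x r₀ = u r₀) (hyv : y r₀ = v r₀)
    (h₀ : ‖G' r₀ - G r₀‖ ≤ δ) (h₁ : ‖G' r₁ - G r₁‖ ≤ δ)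
    (hη : (∫ r in min r₀ r₁..max r₀ r₁, |q r - q' r|) +
      A * (∫ r in min r₀ r₁..max r₀ r₁, ‖G' r - G r‖) ≤ η) :
    ‖x r₁ - u r₁‖ + ‖y r₁ - v r₁‖ ≤ 2 * (growthConst A κ ^ 2 * Real.exp (κ * |r₁ - r₀|) *
      (‖u r₀‖ + ‖v r₀‖) * (η + 2 * δ)) := by
  set K := growthConst A κ with hK
  have hK0 : 0 < K := growthConst_pos hA hκ
  set B := K ^ 2 * Real.exp (κ * |r₁ - r₀|) * (‖u r₀‖ + ‖v r₀‖) with hBdef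
  have hB0 : 0 ≤ B := by positivity
  have key : ∀ α β : 𝕜, ‖α‖ + ‖β‖ = 1 →
      ‖α * (y r₁ - v r₁) - β * (x r₁ - u r₁)‖ ≤ B * (η + 2 * δ) := by
    intro α β hαβ
    obtain ⟨φ, ψ, hφ, hφ₁, hψ₁⟩ := hS.exists_solution r₁ α β
    have hB : ∀ r ∈ Icc (min r₀ r₁) (max r₀ r₁),
        (‖φ r‖ + ‖ψ r‖) * (‖u r‖ + ‖v r‖) ≤ B := by
      intro r hr
      have b₁ := hS.norm_solution_le_exp hA hκ hAN hφ r₁ r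
      have b₂ := hS'.norm_solution_le_exp hA hκ hAN hu r₀ r
      rw [hφ₁, hψ₁, hαβ, mul_one] at b₁
      refine (mul_le_mul b₁ b₂ (by positivity) (by positivity)).trans_eq ?_
      have : |r₁ - r₀| = |r - r₁| + |r - r₀| := by
        rcases le_total r₀ r₁ with h | h
        · rw [min_eq_left h, max_eq_right h] at hr
          rw [abs_of_nonneg (sub_nonneg.2 h), abs_of_nonneg (sub_nonneg.2 hr.1),
            abs_of_nonpos (sub_nonpos.2 hr.2)]
          ring
        · rw [min_eq_right h, max_eq_left h] at hr
          rw [abs_of_nonpos (sub_nonpos.2 h), abs_of_nonneg (sub_nonneg.2 hr.1),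
            abs_of_nonpos (sub_nonpos.2 hr.2)]
          ring
      have hexp : Real.exp (κ * |r₁ - r₀|) =
          Real.exp (κ * |r - r₁|) * Real.exp (κ * |r - r₀|) := by
        rw [← Real.exp_add, this, mul_add]
      rw [hBdef, hexp, hK]
      ring
    have hd := norm_corrected_wronskian_sub_le hS hS' hφ hu hG hG' min_le_max hB
    have hd' : ‖(φ r₁ * v r₁ - ψ r₁ * u r₁ - (G' r₁ - G r₁) * (φ r₁ * u r₁)) -
      (φ r₀ * v r₀ - ψ r₀ * u r₀ - (G' r₀ - G r₀) * (φ r₀ * u r₀))‖ ≤ B * η := by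
      refine le_trans ?_ (hd.trans (mul_le_mul_of_nonneg_left hη hB0))
      rcases le_total r₀ r₁ with h | h
      · rw [min_eq_left h, max_eq_right h]
      · rw [min_eq_right h, max_eq_left h, norm_sub_rev]
    have hw := hφ.wronskian_eq hx r₀ r₁
    rw [hxu, hyv] at hw
    have e : α * (y r₁ - v r₁) - β * (x r₁ - u r₁) =
        (-(G' r₁ - G r₁) * (φ r₁ * u r₁) + (G' r₀ - G r₀) * (φ r₀ * u r₀)) -
        ((φ r₁ * v r₁ - ψ r₁ * u r₁ - (G' r₁ - G r₁) * (φ r₁ * u r₁)) -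
        (φ r₀ * v r₀ - ψ r₀ * u r₀ - (G' r₀ - G r₀) * (φ r₀ * u r₀))) := by
      rw [← hφ₁, ← hψ₁]
      linear_combination hw
    have hE : ∀ r ∈ Icc (min r₀ r₁) (max r₀ r₁), ‖G' r - G r‖ ≤ δ →
        ‖(G' r - G r) * (φ r * u r)‖ ≤ B * δ := by
      intro r hr hδ
      rw [norm_mul, mul_comm]
      refine mul_le_mul ?_ hδ (norm_nonneg _) hB0
      refine le_trans ?_ (hB r hr)
      rw [norm_mul]
      exact mul_le_mul (le_add_of_nonneg_right (norm_nonneg _))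
        (le_add_of_nonneg_right (norm_nonneg _)) (norm_nonneg _) (by positivity)
    have hE₀ := hE r₀ ⟨min_le_left _ _, le_max_left _ _⟩ h₀
    have hE₁ := hE r₁ ⟨min_le_right _ _, le_max_right _ _⟩ h₁
    rw [e]
    refine (norm_sub_le _ _).trans ((add_le_add ((norm_add_le _ _).trans
      (add_le_add ?_ hE₀)) hd').trans_eq (b := B * δ + B * δ + B * η) ?_)
    · rwa [neg_mul, norm_neg]
    · ring
  have k₁ := key 1 0 (by simp)
  have k₂ := key 0 1 (by simp)
  simp only [one_mul, zero_mul, sub_zero, zero_sub, norm_neg] at k₁ k₂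
  linarith

end Comparison

/-! ### The seminorm controls the primitive in `L₁` -/

/-- The normalized distribution function of a real local measure. -/
noncomputable def RealLocalMeasure.cdf (μ : RealLocalMeasure) (t : ℝ) : ℝ :=
  μ.integralBetween (fun _ => (1 : ℝ)) 0 t

theorem hasRNDeriv_distribution (ν : Measure ℝ) [IsLocallyFiniteMeasure ν] :
    HasRNDeriv ν (fun t => ∫ _ in (0 : ℝ)..t, (1 : ℝ) ∂ν) (fun _ => (1 : ℝ)) :=
  ⟨locallyIntegrable_const 1, 0, fun t => by simp⟩

theorem RealLocalMeasure.measurable_cdf (μ : RealLocalMeasure) : Measurable μ.cdf := by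
  have := μ.pos_locallyFinite
  have := μ.neg_locallyFinite
  exact (hasRNDeriv_distribution μ.pos).measurable.sub (hasRNDeriv_distribution μ.neg).measurable

theorem RealLocalMeasure.exists_bound_cdf (μ : RealLocalMeasure) (s t : ℝ) :
    ∃ B, ∀ x ∈ Icc s t, ‖μ.cdf x‖ ≤ B := by
  have := μ.pos_locallyFinite
  have := μ.neg_locallyFinite
  obtain ⟨B₁, h₁⟩ := (hasRNDeriv_distribution μ.pos).exists_bound s t
  obtain ⟨B₂, h₂⟩ := (hasRNDeriv_distribution μ.neg).exists_bound s t
  exact ⟨B₁ + B₂, fun x hx => (norm_sub_le _ _).trans (add_le_add (h₁ x hx) (h₂ x hx))⟩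

theorem RealLocalMeasure.intervalIntegrable_cdf (μ : RealLocalMeasure) (s t : ℝ) :
    IntervalIntegrable μ.cdf volume s t := by
  rcases le_total s t with h | h
  · exact intervalIntegrable_of_bounded μ.measurable_cdf h (μ.exists_bound_cdf s t)
  · exact (intervalIntegrable_of_bounded μ.measurable_cdf h (μ.exists_bound_cdf t s)).symm

theorem integral_eq_neg_integral_mul_distribution (ν : Measure ℝ) [IsLocallyFiniteMeasure ν]
    {u g : ℝ → ℝ} {s t : ℝ} (hst : s ≤ t) (hu : HasRNDeriv volume u g)
    (hs : ∀ x ≤ s, u x = 0) (ht : ∀ x, t ≤ x → u x = 0) :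
    IntervalIntegrable (fun r => g r * ∫ _ in (0 : ℝ)..r, (1 : ℝ) ∂ν) volume s t ∧
    ∫ x, u x ∂ν = -∫ r in s..t, g r * ∫ _ in (0 : ℝ)..r, (1 : ℝ) ∂ν := by
  obtain ⟨i, -, e⟩ := hu.mul_sub_mul (hasRNDeriv_distribution ν) hst
  refine ⟨i, ?_⟩
  rw [hs s le_rfl, ht t le_rfl] at e
  simp only [mul_one, zero_mul, sub_zero] at e
  have : ∫ x, u x ∂ν = ∫ x in s..t, u x ∂ν := by
    rw [intervalIntegral.integral_of_le hst]
    refine (setIntegral_eq_integral_of_forall_compl_eq_zero fun x hx => ?_).symm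
    by_cases h : s < x
    · exact ht x (not_lt.1 fun h' => hx ⟨h, h'.le⟩)
    · exact hs x (not_lt.1 h)
  rw [this]
  linarith

theorem RealLocalMeasure.integral_eq_neg_integral_mul_cdf (μ : RealLocalMeasure)
    {u g : ℝ → ℝ} {s t : ℝ} (hst : s ≤ t) (hu : HasRNDeriv volume u g)
    (hs : ∀ x ≤ s, u x = 0) (ht : ∀ x, t ≤ x → u x = 0) :
    IntervalIntegrable (fun r => g r * μ.cdf r) volume s t ∧
    μ.integral u = -∫ r in s..t, g r * μ.cdf r := by
  have := μ.pos_locallyFinite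
  have := μ.neg_locallyFinite
  obtain ⟨i₁, e₁⟩ := integral_eq_neg_integral_mul_distribution μ.pos hst hu hs ht
  obtain ⟨i₂, e₂⟩ := integral_eq_neg_integral_mul_distribution μ.neg hst hu hs ht
  have : (fun r => g r * μ.cdf r) = fun r => (g r * ∫ _ in (0 : ℝ)..r, (1 : ℝ) ∂μ.pos) -
      g r * ∫ _ in (0 : ℝ)..r, (1 : ℝ) ∂μ.neg := by
    funext r
    simp only [cdf, integralBetween]
    ring
  rw [this]
  refine ⟨i₁.sub i₂, ?_⟩
  rw [intervalIntegral.integral_sub i₁ i₂, RealLocalMeasure.integral, e₁, e₂]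
  ring

/-- The seminorm bounds the pairing of the primitive of `μ' - μ` with functions `g` of mean zero, as
the primitive of such a `g` is an admissible test function and can be integrated by parts. -/
theorem abs_integral_mul_cdf_sub_le {μ μ' : RealLocalMeasure} {I : Set ℝ} {S x : ℝ} (hS0 : 0 ≤ S)
    (hS : seminormSub I μ μ' ≤ ENNReal.ofReal S) (hI : Icc x (x + 2) ⊆ I)
    {g : ℝ → ℝ} (hgm : Measurable g) (hg : ∀ r, |g r| ≤ 1)
    (hg0 : ∫ r in x..(x + 2), g r = 0) :
    |∫ r in x..(x + 2), g r * (μ'.cdf r - μ.cdf r)| ≤ S := by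
  -- the primitive of the truncated `g` vanishes to the right of `x + 2` since `g` has mean zero
  set g' : ℝ → ℝ := (Ioc x (x + 2)).indicator g with hg'
  have hx2 : x ≤ x + 2 := by linarith
  have hg'm : Measurable g' := hgm.indicator measurableSet_Ioc
  have hg'b : ∀ r, ‖g' r‖ ≤ 1 := fun r => (norm_indicator_le_norm_self _ _).trans (hg r)
  have hu : HasRNDeriv volume (fun t => ∫ r in x..t, g' r) g' :=
    ⟨locallyIntegrable_of_intervalIntegrable fun s t hst =>
      intervalIntegrable_of_bounded hg'm hst ⟨1, fun y _ => hg'b y⟩, x, fun t => by simp⟩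
  set u : ℝ → ℝ := fun t => ∫ r in x..t, g' r with hudef
  have hs : ∀ y ≤ x, u y = 0 := by
    intro y hy
    rw [hudef]
    simp only
    rw [intervalIntegral.integral_symm, intervalIntegral.integral_of_le hy, neg_eq_zero]
    refine setIntegral_eq_zero_of_forall_eq_zero fun z hz => ?_
    exact indicator_of_notMem (fun h' => absurd h'.1 (not_lt.2 hz.2)) _
  have hux : u (x + 2) = 0 := by
    rw [← hg0, hudef]
    simp only
    rw [intervalIntegral.integral_of_le hx2, intervalIntegral.integral_of_le hx2]
    exact setIntegral_congr_fun measurableSet_Ioc fun z hz => indicator_of_mem hz _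
  have ht : ∀ y, x + 2 ≤ y → u y = 0 := by
    intro y hy
    rw [hu.eq_add (x + 2) y, hux, zero_add, intervalIntegral.integral_of_le hy]
    refine setIntegral_eq_zero_of_forall_eq_zero fun z hz => ?_
    exact indicator_of_notMem (fun h' => absurd h'.2 (not_le.2 hz.1)) _
  have hsupp : tsupport u ⊆ Icc x (x + 2) := by
    refine closure_minimal (fun y hy => ?_) isClosed_Icc
    by_contra h
    refine hy ?_
    by_cases h' : x ≤ y
    · exact ht y (not_lt.1 fun h'' => h ⟨h', h''.le⟩)
    · exact hs y (not_le.1 h').le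
  have hmem : u ∈ seminormTests I := by
    refine ⟨hsupp.trans hI, (Metric.ediam_mono hsupp).trans ?_, g', hu, ?_⟩
    · rw [Real.ediam_Icc]
      simp
    · rw [eLpNorm_exponent_top]
      exact (eLpNormEssSup_le_of_ae_bound (C := 1) (ae_of_all _ hg'b)).trans (by simp)
  have h1 : ENNReal.ofReal |μ.integral u - μ'.integral u| ≤ ENNReal.ofReal S :=
    le_trans (le_iSup₂ (f := fun u _ => ENNReal.ofReal |μ.integral u - μ'.integral u|) u hmem) hS
  have h2 := (ENNReal.ofReal_le_ofReal_iff hS0).1 h1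
  obtain ⟨i₁, e₁⟩ := μ.integral_eq_neg_integral_mul_cdf hx2 hu hs ht
  obtain ⟨i₂, e₂⟩ := μ'.integral_eq_neg_integral_mul_cdf hx2 hu hs ht
  have e : ∫ r in x..(x + 2), g r * (μ'.cdf r - μ.cdf r) = μ.integral u - μ'.integral u := by
    rw [e₁, e₂, sub_neg_eq_add, neg_add_eq_sub, ← intervalIntegral.integral_sub i₂ i₁,
      intervalIntegral.integral_of_le hx2, intervalIntegral.integral_of_le hx2]
    refine setIntegral_congr_fun measurableSet_Ioc fun z hz => ?_
    simp only [hg', indicator_of_mem hz]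
    ring
  rwa [e]

/-- On an interval of length `2`, the primitive deviates from its mean by at most twice the seminorm
in `L₁`: test with the primitive of the centred sign of the deviation. -/
theorem integral_abs_cdf_sub_mean_le {μ μ' : RealLocalMeasure} {I : Set ℝ} {S x : ℝ} (hS0 : 0 ≤ S)
    (hS : seminormSub I μ μ' ≤ ENNReal.ofReal S) (hI : Icc x (x + 2) ⊆ I) :
    ∫ r in x..(x + 2), |μ'.cdf r - μ.cdf r - (∫ y in x..(x + 2), (μ'.cdf y - μ.cdf y)) / 2| ≤
      2 * S := by
  have hx2 : x ≤ x + 2 := by linarith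
  set D : ℝ → ℝ := fun r => μ'.cdf r - μ.cdf r with hD
  have hDm : Measurable D := μ'.measurable_cdf.sub μ.measurable_cdf
  have hDi : IntervalIntegrable D volume x (x + 2) :=
    (μ'.intervalIntegrable_cdf _ _).sub (μ.intervalIntegrable_cdf _ _)
  set m := (∫ y in x..(x + 2), D y) / 2 with hm
  set σ : ℝ → ℝ := fun r => if 0 ≤ D r - m then 1 else -1 with hσ
  have hσm : Measurable σ :=
    Measurable.ite (measurableSet_le measurable_const (hDm.sub_const m)) measurable_const
      measurable_const
  have hσ1 : ∀ r, |σ r| ≤ 1 := by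
    intro r; simp only [hσ]; split_ifs <;> simp
  have hσi : IntervalIntegrable σ volume x (x + 2) :=
    intervalIntegrable_of_bounded hσm hx2 ⟨1, fun y _ => hσ1 y⟩
  have hσDi : IntervalIntegrable (fun r => σ r * D r) volume x (x + 2) := by
    refine IntervalIntegrable.mono_fun hDi (hσm.mul hDm).aestronglyMeasurable
      (ae_of_all _ fun r => ?_)
    simp only [norm_mul]
    exact mul_le_of_le_one_left (norm_nonneg _) (hσ1 r)
  set b := (∫ y in x..(x + 2), σ y) / 2 with hb
  have hb1 : |b| ≤ 1 := by
    have := intervalIntegral.norm_integral_le_of_norm_le_const (a := x) (b := x + 2) (f := σ)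
      (C := 1) fun y _ => hσ1 y
    rw [Real.norm_eq_abs] at this
    rw [hb, abs_div, abs_two, div_le_iff₀ two_pos]
    refine this.trans_eq ?_
    rw [add_sub_cancel_left, abs_two]
  have key := abs_integral_mul_cdf_sub_le hS0 hS hI (g := fun r => (σ r - b) / 2)
    ((hσm.sub_const b).div_const 2) (fun r => by
      rw [abs_div, abs_two, div_le_iff₀ two_pos]
      calc |σ r - b| ≤ |σ r| + |b| := abs_sub _ _
        _ ≤ 1 * 2 := by linarith [hσ1 r]) (by
      rw [intervalIntegral.integral_div, intervalIntegral.integral_sub hσi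
        intervalIntegrable_const, intervalIntegral.integral_const, smul_eq_mul]
      rw [show (∫ y in x..(x + 2), σ y) = 2 * b by rw [hb]; ring]
      ring)
  have e1 : (∫ r in x..(x + 2), (σ r - b) / 2 * (μ'.cdf r - μ.cdf r)) =
      (∫ r in x..(x + 2), σ r * D r) / 2 - b / 2 * ∫ r in x..(x + 2), D r := by
    rw [← intervalIntegral.integral_div, ← intervalIntegral.integral_const_mul,
      ← intervalIntegral.integral_sub (hσDi.div_const 2) (hDi.const_mul _)]
    exact intervalIntegral.integral_congr fun r _ => by simp only [hD]; ring
  have e2 : (∫ r in x..(x + 2), |D r - m|) =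
      (∫ r in x..(x + 2), σ r * D r) - (∫ r in x..(x + 2), σ r) * m := by
    rw [← intervalIntegral.integral_mul_const, ← intervalIntegral.integral_sub hσDi
      (hσi.mul_const _)]
    refine intervalIntegral.integral_congr fun r _ => ?_
    simp only [hσ]
    split_ifs with h
    · rw [abs_of_nonneg h]; ring
    · rw [abs_of_neg (not_le.1 h)]; ring
  have e3 : (∫ r in x..(x + 2), |D r - m|) =
      2 * ∫ r in x..(x + 2), (σ r - b) / 2 * (μ'.cdf r - μ.cdf r) := by
    rw [e1, e2, show (∫ y in x..(x + 2), σ y) = 2 * b by rw [hb]; ring,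
      show (∫ y in x..(x + 2), D y) = 2 * m by rw [hm]; ring]
    ring
  change (∫ r in x..(x + 2), |D r - m|) ≤ 2 * S
  rw [e3]
  linarith [le_abs_self (∫ r in x..(x + 2), (σ r - b) / 2 * (μ'.cdf r - μ.cdf r))]

/-- Local constants that approximate `D` in `L₁` on all subintervals of length `2` of `[α, β]` can be
replaced by a single one, at the cost of a factor quadratic in `β - α`. -/
theorem integral_abs_sub_le_of_local {D m : ℝ → ℝ} {α β ε : ℝ} (hε : 0 ≤ ε) (hαβ : α + 2 ≤ β)
    (hD : ∀ s t, IntervalIntegrable D volume s t)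
    (h : ∀ x ∈ Icc α (β - 2), ∫ r in x..(x + 2), |D r - m x| ≤ ε) :
    ∫ r in α..β, |D r - m α| ≤ (β - α + 2) * (1 + 4 * (β - α)) * ε := by
  have hi : ∀ k s t, IntervalIntegrable (fun r => |D r - k|) volume s t := fun k s t =>
    ((hD s t).sub intervalIntegrable_const).abs
  have hsub : ∀ k s t a b, s ≤ t → a ≤ s → t ≤ b →
      ∫ r in s..t, |D r - k| ≤ ∫ r in a..b, |D r - k| := fun k s t a b hst has htb =>
    intervalIntegral.integral_mono_interval has hst htb
      (ae_of_all _ fun r => abs_nonneg _) (hi k a b)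
  have hstep : ∀ x ∈ Icc α (β - 2), ∀ y ∈ Icc α (β - 2), x ≤ y → y ≤ x + 1 →
      |m y - m x| ≤ 2 * ε := by
    intro x hx y hy hxy hyx
    have h1 : ∫ r in y..(y + 1), |D r - m x| ≤ ε :=
      (hsub _ _ _ _ _ (by linarith) hxy (by linarith)).trans (h x hx)
    have h2 : ∫ r in y..(y + 1), |D r - m y| ≤ ε :=
      (hsub _ _ _ _ _ (by linarith) le_rfl (by linarith)).trans (h y hy)
    have h3 : ∫ r in y..(y + 1), |m y - m x| ≤
        ∫ r in y..(y + 1), (|D r - m x| + |D r - m y|) := by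
      refine intervalIntegral.integral_mono_on (by linarith) intervalIntegrable_const
        ((hi _ _ _).add (hi _ _ _)) fun r _ => ?_
      have := abs_sub (D r - m x) (D r - m y)
      rwa [show D r - m x - (D r - m y) = m y - m x by ring] at this
    rw [intervalIntegral.integral_add (hi _ _ _) (hi _ _ _),
      intervalIntegral.integral_const, smul_eq_mul] at h3
    linarith
  have hm : ∀ n : ℕ, ∀ y ∈ Icc α (β - 2), y ≤ α + n → |m y - m α| ≤ 2 * ε * n := by
    intro n
    induction n with
    | zero =>
      intro y hy hyn
      have : y = α := le_antisymm (by simpa using hyn) hy.1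
      simp [this]
    | succ n ih =>
      intro y hy hyn
      push_cast at hyn ⊢
      have hz : max α (y - 1) ∈ Icc α (β - 2) :=
        ⟨le_max_left _ _, max_le (by linarith) (by linarith [hy.2])⟩
      have h1 := ih _ hz (max_le (by linarith [n.cast_nonneg (α := ℝ)]) (by linarith))
      have h2 := hstep _ hz y hy (max_le hy.1 (by linarith))
        (by linarith [le_max_right α (y - 1)])
      have h3 := abs_add_le (m y - m (max α (y - 1))) (m (max α (y - 1)) - m α)
      rw [sub_add_sub_cancel] at h3
      linarith
  set L := β - α with hL
  have hL2 : 2 ≤ L := by linarith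
  have hloc : ∀ x ∈ Icc α (β - 2), ∫ r in x..(x + 2), |D r - m α| ≤ (1 + 4 * L) * ε := by
    intro x hx
    have h1 := hm ⌈x - α⌉₊ x hx (by linarith [Nat.le_ceil (x - α)])
    have h2 : (⌈x - α⌉₊ : ℝ) ≤ L :=
      (Nat.ceil_lt_add_one (by linarith [hx.1])).le.trans (by linarith [hx.2])
    have h3 : |m x - m α| ≤ 2 * ε * L := h1.trans (by gcongr)
    have h4 : ∫ r in x..(x + 2), |D r - m α| ≤
        ∫ r in x..(x + 2), (|D r - m x| + 2 * ε * L) := by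
      refine intervalIntegral.integral_mono_on (by linarith) (hi _ _ _)
        ((hi _ _ _).add intervalIntegrable_const) fun r _ => ?_
      have := abs_add_le (D r - m x) (m x - m α)
      rw [sub_add_sub_cancel] at this
      linarith
    rw [intervalIntegral.integral_add (hi _ _ _) intervalIntegrable_const,
      intervalIntegral.integral_const, smul_eq_mul] at h4
    have := h x hx
    linarith
  have hc0 : 0 ≤ (1 + 4 * L) * ε := by positivity
  have hF : ∀ n : ℕ, ∀ y ∈ Icc α β, y ≤ α + 2 * (n + 1) →
      ∫ r in α..y, |D r - m α| ≤ (n + 1) * ((1 + 4 * L) * ε) := by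
    intro n
    induction n with
    | zero =>
      intro y hy hyn
      have := (hsub (m α) α y α (α + 2) hy.1 le_rfl (by simpa using hyn)).trans
        (hloc α ⟨le_rfl, by linarith⟩)
      simpa using this
    | succ n ih =>
      intro y hy hyn
      push_cast at hyn ⊢
      rcases le_total y (α + 2) with h2 | h2
      · have := (hsub (m α) α y α (α + 2) hy.1 le_rfl h2).trans (hloc α ⟨le_rfl, by linarith⟩)
        nlinarith [n.cast_nonneg (α := ℝ)]
      · have h3 := ih (y - 2) ⟨by linarith, by linarith [hy.2]⟩ (by linarith)
        have h4 := hloc (y - 2) ⟨by linarith, by linarith [hy.2]⟩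
        rw [sub_add_cancel] at h4
        rw [← intervalIntegral.integral_add_adjacent_intervals (hi _ α (y - 2)) (hi _ (y - 2) y)]
        linarith
  have h1 := hF ⌈L⌉₊ β ⟨by linarith, le_rfl⟩ (by linarith [Nat.le_ceil L])
  have h2 : (⌈L⌉₊ : ℝ) ≤ L + 1 := (Nat.ceil_lt_add_one (by linarith)).le
  calc _ ≤ _ := h1
    _ ≤ (L + 2) * ((1 + 4 * L) * ε) := mul_le_mul_of_nonneg_right (by linarith) hc0
    _ = _ := by ring

/-- The seminorm on `[-p, p]` controls the distance in `L₁(-p, p)` of the primitive of `μ' - μ` to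
the constants. -/
theorem exists_integral_abs_cdf_sub_le {μ μ' : RealLocalMeasure} {p S : ℝ} (hp : 1 ≤ p)
    (hS0 : 0 ≤ S) (hS : seminormSub (Icc (-p) p) μ μ' ≤ ENNReal.ofReal S) :
    ∃ k : ℝ, ∫ r in (-p)..p, |μ'.cdf r - μ.cdf r - k| ≤ 32 * (p + 1) ^ 2 * S := by
  have h := integral_abs_sub_le_of_local (D := fun r => μ'.cdf r - μ.cdf r)
    (m := fun x => (∫ y in x..(x + 2), (μ'.cdf y - μ.cdf y)) / 2) (α := -p) (β := p)
    (ε := 2 * S) (by positivity) (by linarith)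
    (fun s t => (μ'.intervalIntegrable_cdf _ _).sub (μ.intervalIntegrable_cdf _ _))
    (fun x hx => integral_abs_cdf_sub_mean_le hS0 hS
      (Icc_subset_Icc hx.1 (by linarith [hx.2])))
  refine ⟨_, h.trans ?_⟩
  nlinarith

theorem exists_le_of_integral_le {f : ℝ → ℝ} {a δ : ℝ}
    (hf : IntervalIntegrable f volume a (a + 1)) (h : ∫ r in a..(a + 1), f r ≤ δ) :
    ∃ c ∈ Icc a (a + 1), f c ≤ δ := by
  by_contra! hc
  have := intervalIntegral.intervalIntegral_pos_of_pos_on (f := fun r => f r - δ)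
    (hf.sub intervalIntegrable_const) (fun x hx => sub_pos.2 (hc x ⟨hx.1.le, hx.2.le⟩))
    (by linarith : a < a + 1)
  rw [intervalIntegral.integral_sub hf intervalIntegrable_const,
    intervalIntegral.integral_const, smul_eq_mul] at this
  linarith

/-! ### Solutions in `L_p(ρ)` tend to zero -/

section Periodic

variable {ρ : Measure ℝ} {P : ℝ}

theorem measure_ball_add_period (h : translateMeasure ρ P = ρ) (x δ : ℝ) :
    ρ (Metric.ball (x + P) δ) = ρ (Metric.ball x δ) := by
  conv_rhs => rw [← h]
  rw [translateMeasure, (measurableEmbedding_sub_const P).map_apply]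
  congr 1
  ext y
  simp only [mem_preimage, Metric.mem_ball, Real.dist_eq]
  ring_nf

theorem measure_ball_add_zsmul_period (h : translateMeasure ρ P = ρ) (x δ : ℝ) (n : ℤ) :
    ρ (Metric.ball (x + n • P) δ) = ρ (Metric.ball x δ) := by
  induction n with
  | zero => simp
  | succ n ih => rw [add_zsmul, one_zsmul, ← add_assoc, measure_ball_add_period h, ih]
  | pred n ih =>
    rw [← measure_ball_add_period h (x + (-(n : ℤ) - 1) • P), sub_zsmul, one_zsmul, add_assoc,
      neg_add_cancel_right, ih]

theorem mem_support_iff_ball {x : ℝ} :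
    x ∈ ρ.support ↔ ∀ δ > 0, 0 < ρ (Metric.ball x δ) :=
  Metric.nhds_basis_ball.mem_measureSupport

theorem add_zsmul_mem_support (h : translateMeasure ρ P = ρ) {x : ℝ} (hx : x ∈ ρ.support)
    (n : ℤ) : x + n • P ∈ ρ.support := by
  rw [mem_support_iff_ball] at hx ⊢
  intro δ hδ
  rw [measure_ball_add_zsmul_period h]
  exact hx δ hδ

theorem exists_mem_support_Ico (h : translateMeasure ρ P = ρ) (hP : 0 < P) (hρ : ρ ≠ 0) (t : ℝ) :
    ∃ x ∈ ρ.support, x ∈ Ico t (t + P) := by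
  obtain ⟨x₀, hx₀⟩ := Measure.nonempty_support hρ
  refine ⟨toIcoMod hP t x₀, ?_, toIcoMod_mem_Ico hP t x₀⟩
  have := add_zsmul_mem_support h hx₀ (-toIcoDiv hP t x₀)
  rwa [neg_zsmul, ← sub_eq_add_neg] at this

/-- By periodicity and compactness, balls around the points of the support have mass bounded below in
terms of their radius. -/
theorem exists_le_measure_ball (h : translateMeasure ρ P = ρ) (hP : 0 < P) {δ : ℝ} (hδ : 0 < δ) :
    ∃ m : ℝ≥0∞, 0 < m ∧ ∀ x ∈ ρ.support, m ≤ ρ (Metric.ball x δ) := by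
  have hK : IsCompact (Icc 0 P ∩ ρ.support) := isCompact_Icc.inter_right Measure.isClosed_support
  obtain ⟨F, hFK, hF⟩ := hK.elim_nhds_subcover (fun x => Metric.ball x (δ / 2))
    fun x _ => Metric.ball_mem_nhds x (half_pos hδ)
  refine ⟨F.inf fun x => ρ (Metric.ball x (δ / 2)), ?_, fun x hx => ?_⟩
  · rw [Finset.lt_inf_iff (by simp)]
    exact fun y hy => mem_support_iff_ball.1 (hFK y hy).2 _ (half_pos hδ)
  · have h1 : toIcoMod hP 0 x ∈ ρ.support := by
      have := add_zsmul_mem_support h hx (-toIcoDiv hP 0 x)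
      rwa [neg_zsmul, ← sub_eq_add_neg] at this
    have h2 := toIcoMod_mem_Ico hP 0 x
    rw [zero_add] at h2
    have h3 := hF ⟨⟨h2.1, h2.2.le⟩, h1⟩
    simp only [mem_iUnion] at h3
    obtain ⟨y, hy, hxy⟩ := h3
    have h4 : ρ (Metric.ball x δ) = ρ (Metric.ball (toIcoMod hP 0 x) δ) := by
      have := measure_ball_add_zsmul_period h x δ (-toIcoDiv hP 0 x)
      rw [neg_zsmul, ← sub_eq_add_neg] at this
      exact this.symm
    rw [h4]
    refine (Finset.inf_le hy).trans (measure_mono fun z hz => ?_)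
    rw [Metric.mem_ball] at *
    have := dist_triangle_right z (toIcoMod hP 0 x) y
    linarith

end Periodic

section Decay

variable {𝕜 : Type*} [RCLike 𝕜]

/-- A solution is nowhere uniformly small on the support of `ρ` over two periods, relative to its
initial data: otherwise `v` would be nearly constant, as `θ` is carried by the support of `ρ`, and
the values of `u` at two points of the support would determine `u` and `v` to be small. -/
theorem IsSystem.exists_mem_support_le {A N q₀ P : ℝ} (hq₀ : 0 < q₀) (hP : 0 < P)
    {q : ℝ → ℝ} {θ ρ : Measure ℝ} [IsLocallyFiniteMeasure θ] {h u v : ℝ → 𝕜}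
    (hS : IsSystem A N q θ h) (hq : ∀ t, q₀ ≤ q t) (huv : IsSolution q θ h u v)
    (hsupp : θ ρ.supportᶜ = 0) (hper : translateMeasure ρ P = ρ) (hρ : ρ ≠ 0) :
    ∃ η > 0, ∀ t, ∃ x ∈ ρ.support, x ∈ Icc t (t + 2 * P) ∧ η * (‖u t‖ + ‖v t‖) ≤ ‖u x‖ := by
  have hA : 0 ≤ A := (hS.q_nonneg 0).trans (hS.q_le 0)
  have hN := hS.N_nonneg
  set M := N * (2 * P + 1) with hM
  have hM0 : 0 ≤ M := by positivity
  set c := (2 + A * M * P) / (q₀ * P) * (1 + A * P) + 1 + A * M * P with hc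
  have hc0 : 0 < c := by positivity
  refine ⟨1 / (2 * c), by positivity, fun t => ?_⟩
  by_contra! hcon
  set F := ‖u t‖ + ‖v t‖ with hF
  set m := 1 / (2 * c) * F with hm
  obtain ⟨x, hx, hxt⟩ := exists_mem_support_Ico hper hP hρ t
  have hy : x + P ∈ ρ.support := by simpa using add_zsmul_mem_support hper hx 1
  have bx := hcon x hx ⟨hxt.1, by linarith [hxt.2]⟩
  have by' := hcon (x + P) hy ⟨by linarith [hxt.1], by linarith [hxt.2]⟩
  have hm0 : 0 < m := (norm_nonneg _).trans_lt bx
  have hv : ∀ s ∈ Icc t (t + 2 * P), ‖v s - v t‖ ≤ m * M := by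
    intro s hs
    have hθ : θ (Ioc t s) ≤ ENNReal.ofReal M :=
      (measure_Ioc_le_of_unit hN hS.measure_le hs.1).trans
        (ENNReal.ofReal_le_ofReal (mul_le_mul_of_nonneg_left (by linarith [hs.2]) hN))
    rw [huv.2.sub_eq t s, intervalIntegral.integral_of_le hs.1]
    refine (norm_setIntegral_le_of_norm_le_const_ae' (C := m) (hθ.trans_lt ENNReal.ofReal_lt_top)
      ?_).trans ?_
    · have : ∀ᵐ y ∂θ, y ∈ ρ.support := by
        rw [ae_iff]; exact hsupp
      filter_upwards [this] with y hyρ hyt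
      rw [norm_mul]
      exact (mul_le_of_le_one_left (norm_nonneg _) (hS.h_le y)).trans
        (hcon y hyρ ⟨hyt.1.le, hyt.2.trans hs.2⟩).le
    · exact mul_le_mul_of_nonneg_left (ENNReal.toReal_le_of_le_ofReal hM0 hθ) hm0.le
  have hqi : ∀ a b, IntervalIntegrable (fun r => (q r : 𝕜)) volume a b := by
    have : ∀ a b, a ≤ b → IntervalIntegrable (fun r => (q r : 𝕜)) volume a b := fun a b hab =>
      intervalIntegrable_of_bounded (RCLike.measurable_ofReal.comp hS.q_measurable) hab
        ⟨A, fun r _ => by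
          change ‖(q r : 𝕜)‖ ≤ A
          rw [RCLike.norm_ofReal, abs_of_nonneg (hS.q_nonneg r)]; exact hS.q_le r⟩
    intro a b
    rcases le_total a b with hab | hab
    · exact this a b hab
    · exact (this b a hab).symm
  have hqr : IntervalIntegrable q volume x (x + P) :=
    intervalIntegrable_of_bounded (𝕜 := ℝ) hS.q_measurable (by linarith)
      ⟨A, fun r _ => by rw [Real.norm_eq_abs, abs_of_nonneg (hS.q_nonneg r)]; exact hS.q_le r⟩
  -- the increment of `u` between two support points at distance `P` determines `v t`
  have hvt : ‖v t‖ * (q₀ * P) ≤ m * (2 + A * M * P) := by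
    have e : (∫ r in x..(x + P), (q r : 𝕜)) * v t =
        u (x + P) - u x - ∫ r in x..(x + P), (q r : 𝕜) * (v r - v t) := by
      rw [huv.1.sub_eq x (x + P), ← intervalIntegral.integral_mul_const]
      simp only [mul_sub]
      rw [intervalIntegral.integral_sub (huv.1.intervalIntegrable _ _)
        ((hqi _ _).mul_const _)]
      ring
    have b₁ : ‖∫ r in x..(x + P), (q r : 𝕜) * (v r - v t)‖ ≤ A * (m * M) * P := by
      have := intervalIntegral.norm_integral_le_of_norm_le_const (a := x) (b := x + P)
        (f := fun r => (q r : 𝕜) * (v r - v t)) (C := A * (m * M)) fun r hr => by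
          rw [uIoc_of_le (by linarith)] at hr
          rw [norm_mul, RCLike.norm_ofReal, abs_of_nonneg (hS.q_nonneg r)]
          exact mul_le_mul (hS.q_le r)
            (hv r ⟨by linarith [hr.1, hxt.1], by linarith [hr.2, hxt.2]⟩) (norm_nonneg _) hA
      rwa [add_sub_cancel_left, abs_of_pos hP] at this
    have b₂ : q₀ * P ≤ ‖∫ r in x..(x + P), (q r : 𝕜)‖ := by
      rw [show (∫ r in x..(x + P), (q r : 𝕜)) = ((∫ r in x..(x + P), q r : ℝ) : 𝕜) by
        rw [intervalIntegral.integral_of_le (by linarith),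
          intervalIntegral.integral_of_le (by linarith), integral_ofReal], RCLike.norm_ofReal]
      refine le_trans ?_ (le_abs_self _)
      have := intervalIntegral.integral_mono_on (by linarith : x ≤ x + P)
        (intervalIntegrable_const (c := q₀)) hqr fun r _ => hq r
      rwa [intervalIntegral.integral_const, add_sub_cancel_left, smul_eq_mul, mul_comm] at this
    calc ‖v t‖ * (q₀ * P) ≤ ‖v t‖ * ‖∫ r in x..(x + P), (q r : 𝕜)‖ := by gcongr
      _ = ‖(∫ r in x..(x + P), (q r : 𝕜)) * v t‖ := by rw [norm_mul, mul_comm]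
      _ ≤ ‖u (x + P)‖ + ‖u x‖ + A * (m * M) * P := by
          rw [e]
          exact (norm_sub_le _ _).trans (add_le_add (norm_sub_le _ _) b₁)
      _ ≤ m + m + A * (m * M) * P := by linarith
      _ = _ := by ring
  have hut : ‖u t‖ ≤ m + A * (‖v t‖ + m * M) * P := by
    have e : u t = u x - ∫ r in t..x, (q r : 𝕜) * v r := by
      rw [← huv.1.sub_eq t x]; ring
    have b₁ : ‖∫ r in t..x, (q r : 𝕜) * v r‖ ≤ A * (‖v t‖ + m * M) * P := by
      refine (intervalIntegral.norm_integral_le_of_norm_le_const (C := A * (‖v t‖ + m * M))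
        fun r hr => ?_).trans ?_
      · rw [uIoc_of_le hxt.1] at hr
        rw [norm_mul, RCLike.norm_ofReal, abs_of_nonneg (hS.q_nonneg r)]
        refine mul_le_mul (hS.q_le r) ?_ (norm_nonneg _) hA
        have := hv r ⟨hr.1.le, by linarith [hr.2, hxt.2]⟩
        have h2 : ‖v r‖ ≤ ‖v t‖ + ‖v r - v t‖ := by simpa using norm_add_le (v t) (v r - v t)
        linarith
      · rw [abs_of_nonneg (sub_nonneg.2 hxt.1)]
        exact mul_le_mul_of_nonneg_left (by linarith [hxt.2]) (by positivity)
    rw [e]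
    exact (norm_sub_le _ _).trans (add_le_add bx.le b₁)
  have hvt' : ‖v t‖ ≤ m * ((2 + A * M * P) / (q₀ * P)) := by
    rw [← mul_div_assoc, le_div_iff₀ (by positivity)]
    exact hvt
  have hFc : F ≤ m * c := by
    have h1 : ‖v t‖ * (1 + A * P) ≤ m * ((2 + A * M * P) / (q₀ * P)) * (1 + A * P) := by gcongr
    calc F ≤ ‖v t‖ * (1 + A * P) + m + A * (m * M) * P := by rw [hF]; linarith
      _ ≤ m * ((2 + A * M * P) / (q₀ * P)) * (1 + A * P) + m + A * (m * M) * P := by linarith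
      _ = m * c := by rw [hc]; ring
  have hmc : m * c = F / 2 := by rw [hm]; field_simp
  have : 0 < m * c := by positivity
  linarith

theorem exists_setLIntegral_tail_lt {ρ : Measure ℝ} {f : ℝ → ℝ≥0∞} (hf : ∫⁻ x, f x ∂ρ ≠ ∞)
    {m : ℝ≥0∞} (hm : 0 < m) : ∃ R : ℝ, ∫⁻ x in {x | R ≤ |x|}, f x ∂ρ < m := by
  have hs : ∀ n : ℕ, MeasurableSet {x : ℝ | (n : ℝ) ≤ |x|} := fun n =>
    measurableSet_le measurable_const (by fun_prop)
  have h := tendsto_measure_iInter_atTop (μ := ρ.withDensity f)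
    (s := fun n : ℕ => {x : ℝ | (n : ℝ) ≤ |x|}) (fun n => (hs n).nullMeasurableSet)
    (fun a b hab x (hx : (b : ℝ) ≤ |x|) =>
      show (a : ℝ) ≤ |x| from (Nat.cast_le.2 hab).trans hx)
    ⟨0, by
      rw [withDensity_apply _ (hs 0)]
      exact ((setLIntegral_le_lintegral _ _).trans_lt (lt_top_iff_ne_top.2 hf)).ne⟩
  have he : ⋂ n : ℕ, {x : ℝ | (n : ℝ) ≤ |x|} = ∅ := by
    refine eq_empty_of_forall_notMem fun x hx => ?_
    obtain ⟨n, hn⟩ := exists_nat_gt |x|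
    exact absurd (mem_iInter.1 hx n) (not_le.2 hn)
  rw [he, measure_empty] at h
  obtain ⟨n, hn⟩ := (h.eventually_lt_const hm).exists
  refine ⟨n, ?_⟩
  rwa [Function.comp_apply, withDensity_apply _ (hs n)] at hn

/-- Solutions that are `p`-integrable with respect to a periodic measure `ρ` tend to zero, together
with their momentum. -/
theorem IsSystem.exists_forall_norm_le {A N κ q₀ P p : ℝ} (hA : 0 < A) (hκ : 0 < κ)
    (hAN : A * N ≤ κ ^ 2) (hq₀ : 0 < q₀) (hP : 0 < P) (hp : 0 < p)
    {q : ℝ → ℝ} {θ ρ : Measure ℝ} [IsLocallyFiniteMeasure θ] {h u v : ℝ → 𝕜}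
    (hS : IsSystem A N q θ h) (hq : ∀ t, q₀ ≤ q t) (huv : IsSolution q θ h u v)
    (hsupp : θ ρ.supportᶜ = 0) (hper : translateMeasure ρ P = ρ) (hρ : ρ ≠ 0)
    (hu : ∫⁻ x, ‖u x‖ₑ ^ p ∂ρ ≠ ∞) {ε : ℝ} (hε : 0 < ε) :
    ∃ R, ∀ t, R ≤ |t| → ‖u t‖ + ‖v t‖ ≤ ε := by
  obtain ⟨η, hη, hηx⟩ := hS.exists_mem_support_le hq₀ hP hq huv hsupp hper hρ
  set L := 2 * P + 1 with hL
  set K := growthConst A κ * Real.exp (κ * L) with hK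
  have hK0 : 0 < K := mul_pos (growthConst_pos hA hκ) (Real.exp_pos _)
  set δ := min 1 (η / (2 * (A * K))) with hδ
  have hδ0 : 0 < δ := by positivity
  obtain ⟨m, hm, hmx⟩ := exists_le_measure_ball hper hP hδ0
  -- the mass `∫ |u|^p dρ` near `x` that a value `> ε` of `‖u t‖ + ‖v t‖` would produce
  have hlow : 0 < ENNReal.ofReal (η * ε / 2) ^ p * m :=
    ENNReal.mul_pos (ENNReal.rpow_pos (by positivity) ENNReal.ofReal_ne_top).ne' hm.ne'
  obtain ⟨R, hR⟩ := exists_setLIntegral_tail_lt hu hlow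
  refine ⟨R + L, fun t ht => ?_⟩
  by_contra! hcon
  obtain ⟨x, hx, hxt, hux⟩ := hηx t
  set F := ‖u t‖ + ‖v t‖ with hF
  have hgrow : ∀ s, |s - t| ≤ L → ‖u s‖ + ‖v s‖ ≤ K * F := by
    intro s hs
    refine (hS.norm_solution_le_exp hA hκ hAN huv t s).trans ?_
    have := growthConst_pos hA hκ
    rw [hK, hF]
    gcongr
  have hball : ∀ y ∈ Metric.ball x δ, |y - t| ≤ L := by
    intro y hy
    rw [Metric.mem_ball, Real.dist_eq] at hy
    have h1 : |y - x| < 1 := hy.trans_le (min_le_left _ _)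
    rw [abs_lt] at h1
    rw [abs_le]
    constructor <;> linarith [hxt.1, hxt.2]
  have hlarge : ∀ y ∈ Metric.ball x δ, η * ε / 2 ≤ ‖u y‖ := by
    intro y hy
    have hyx : |y - x| < η / (2 * (A * K)) := by
      rw [Metric.mem_ball, Real.dist_eq] at hy
      exact hy.trans_le (min_le_right _ _)
    have hlip : ‖u y - u x‖ ≤ A * (K * F) * |y - x| := by
      rw [huv.1.sub_eq x y]
      refine intervalIntegral.norm_integral_le_of_norm_le_const fun r hr => ?_
      rw [norm_mul, RCLike.norm_ofReal, abs_of_nonneg (hS.q_nonneg r)]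
      refine mul_le_mul (hS.q_le r) ?_ (norm_nonneg _) hA.le
      refine le_trans (le_add_of_nonneg_left (norm_nonneg _)) (hgrow r (hball r ?_))
      rw [Metric.mem_ball, Real.dist_eq]
      rw [Metric.mem_ball, Real.dist_eq] at hy
      exact (abs_sub_left_of_mem_uIcc (uIoc_subset_uIcc hr)).trans_lt hy
    have hF0 : 0 < F := hε.trans hcon
    have h1 : A * (K * F) * |y - x| ≤ η * F / 2 := by
      calc A * (K * F) * |y - x| ≤ A * (K * F) * (η / (2 * (A * K))) := by gcongr
        _ = _ := by field_simp
    have h2 : ‖u x‖ ≤ ‖u y‖ + ‖u y - u x‖ := by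
      simpa using norm_sub_le (u y) (u y - u x)
    have h3 : η * ε ≤ η * F := by gcongr
    linarith
  refine absurd hR (not_lt.2 ?_)
  calc ENNReal.ofReal (η * ε / 2) ^ p * m
      ≤ ENNReal.ofReal (η * ε / 2) ^ p * ρ (Metric.ball x δ) := by gcongr; exact hmx x hx
    _ = ∫⁻ _ in Metric.ball x δ, ENNReal.ofReal (η * ε / 2) ^ p ∂ρ := by
        rw [setLIntegral_const]
    _ ≤ ∫⁻ y in Metric.ball x δ, ‖u y‖ₑ ^ p ∂ρ := by
        refine setLIntegral_mono' Metric.isOpen_ball.measurableSet fun y hy => ?_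
        refine ENNReal.rpow_le_rpow ?_ hp.le
        rw [← ofReal_norm]
        exact ENNReal.ofReal_le_ofReal (hlarge y hy)
    _ ≤ ∫⁻ y in {y | R ≤ |y|}, ‖u y‖ₑ ^ p ∂ρ := by
        refine lintegral_mono_set fun y hy => ?_
        have h1 := hball y hy
        have h2 := abs_sub_abs_le_abs_sub t y
        rw [abs_sub_comm] at h2
        change R ≤ |y|
        linarith

end Decay

/-! ### The three block argument -/

section ThreeBlocks

variable {𝕜 : Type*} [RCLike 𝕜]

/-- By the Cayley–Hamilton theorem for the transfer matrix `M` from `c` to `d`, which has determinant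
one, `M² x - (tr M) M x + x = 0`. Hence `M⁻¹ x`, `M x` and `M² x` cannot all be small compared to
`x`. -/
theorem IsSystem.norm_le_three_blocks {A N : ℝ} {q : ℝ → ℝ} {θ : Measure ℝ}
    [IsLocallyFiniteMeasure θ] {h u₀ v₀ u₁ v₁ u₂ v₂ : ℝ → 𝕜} (hS : IsSystem A N q θ h)
    (h₀ : IsSolution q θ h u₀ v₀) (h₁ : IsSolution q θ h u₁ v₁) (h₂ : IsSolution q θ h u₂ v₂)
    {c d : ℝ} (hu₁ : u₁ c = u₀ d) (hv₁ : v₁ c = v₀ d) (hu₂ : u₂ c = u₁ d) (hv₂ : v₂ c = v₁ d) :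
    ‖u₁ c‖ + ‖v₁ c‖ ≤ (‖u₀ c‖ + ‖v₀ c‖) + (‖u₁ d‖ + ‖v₁ d‖) + (‖u₂ d‖ + ‖v₂ d‖) := by
  obtain ⟨φ, ψ, hφ, hφc, hψc⟩ := hS.exists_solution c (1 : 𝕜) 0
  obtain ⟨χ, ω, hχ, hχc, hωc⟩ := hS.exists_solution c (0 : 𝕜) 1
  have det := hφ.wronskian_eq hχ c d
  rw [hφc, hψc, hχc, hωc] at det
  have transfer : ∀ {u v : ℝ → 𝕜}, IsSolution q θ h u v →
      u d = φ d * u c + χ d * v c ∧ v d = ψ d * u c + ω d * v c := by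
    intro u v huv
    have w₁ := hφ.wronskian_eq huv c d
    have w₂ := hχ.wronskian_eq huv c d
    rw [hφc, hψc] at w₁
    rw [hχc, hωc] at w₂
    constructor
    · linear_combination χ d * w₁ - φ d * w₂ - u d * det
    · linear_combination ω d * w₁ - ψ d * w₂ - v d * det
  obtain ⟨a₀, b₀⟩ := transfer h₀
  obtain ⟨a₁, b₁⟩ := transfer h₁
  obtain ⟨a₂, b₂⟩ := transfer h₂
  rw [← hu₁] at a₀
  rw [← hv₁] at b₀
  rw [hu₂, hv₂] at a₂ b₂
  set τ := φ d + ω d with hτ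
  have e₁ : τ * u₁ c = u₁ d + u₀ c := by
    rw [a₁, hτ]; linear_combination ω d * a₀ - χ d * b₀ + u₀ c * det
  have e₂ : τ * v₁ c = v₁ d + v₀ c := by
    rw [b₁, hτ]; linear_combination φ d * b₀ - ψ d * a₀ + v₀ c * det
  have e₃ : u₁ c = τ * u₁ d - u₂ d := by
    rw [a₂, hτ]; linear_combination -ω d * a₁ + χ d * b₁ - u₁ c * det
  have e₄ : v₁ c = τ * v₁ d - v₂ d := by
    rw [b₂, hτ]; linear_combination -φ d * b₁ + ψ d * a₁ - v₁ c * det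
  rcases le_total ‖τ‖ 1 with hle | hle
  · have n₃ : ‖u₁ c‖ ≤ ‖u₁ d‖ + ‖u₂ d‖ := by
      rw [e₃]
      refine (norm_sub_le _ _).trans (add_le_add_left ?_ _)
      rw [norm_mul]
      exact mul_le_of_le_one_left (norm_nonneg _) hle
    have n₄ : ‖v₁ c‖ ≤ ‖v₁ d‖ + ‖v₂ d‖ := by
      rw [e₄]
      refine (norm_sub_le _ _).trans (add_le_add_left ?_ _)
      rw [norm_mul]
      exact mul_le_of_le_one_left (norm_nonneg _) hle
    linarith [norm_nonneg (u₀ c), norm_nonneg (v₀ c)]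
  · have n₁ : ‖u₁ c‖ ≤ ‖u₁ d‖ + ‖u₀ c‖ := by
      refine le_trans ?_ (norm_add_le _ _)
      rw [← e₁, norm_mul]
      exact le_mul_of_one_le_left (norm_nonneg _) hle
    have n₂ : ‖v₁ c‖ ≤ ‖v₁ d‖ + ‖v₀ c‖ := by
      refine le_trans ?_ (norm_add_le _ _)
      rw [← e₂, norm_mul]
      exact le_mul_of_one_le_left (norm_nonneg _) hle
    linarith [norm_nonneg (u₂ d), norm_nonneg (v₂ d)]

theorem IsSystem.translate {A N : ℝ} {q : ℝ → ℝ} {θ : Measure ℝ} {h : ℝ → 𝕜}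
    (hS : IsSystem A N q θ h) (p : ℝ) :
    IsSystem A N (fun t => q (t + p)) (translateMeasure θ p) (fun t => h (t + p)) where
  q_measurable := hS.q_measurable.comp (measurable_id.add_const p)
  q_nonneg t := hS.q_nonneg _
  q_le t := hS.q_le _
  h_measurable := hS.h_measurable.comp (measurable_id.add_const p)
  h_le t := hS.h_le _
  N_nonneg := hS.N_nonneg
  measure_le t := by
    rw [translateMeasure_Ioc, add_right_comm]
    exact hS.measure_le _

theorem IsSolution.translate {q : ℝ → ℝ} {θ : Measure ℝ} {h u v : ℝ → 𝕜}
    (huv : IsSolution q θ h u v) (p : ℝ) :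
    IsSolution (fun t => q (t + p)) (translateMeasure θ p) (fun t => h (t + p))
      (fun t => u (t + p)) (fun t => v (t + p)) := by
  refine ⟨?_, huv.2.comp_add_right p⟩
  have := huv.1.comp_add_right p
  rwa [show translateMeasure volume p = volume from
    (measurePreserving_sub_right volume p).map_eq] at this

/-- The quantitative form of Gordon's argument. The block boundaries `c`, `c + p` and the points
where the comparison with the translated system ends are chosen such that the primitive `G' - G` of
the difference of the measures is small there; between these points and the block boundaries the
solutions change by bounded factors only. -/
theorem IsSystem.norm_solution_le_of_almost_periodic {A N κ : ℝ} (hA : 0 < A) (hκ : 0 < κ)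
    (hAN : A * N ≤ κ ^ 2) {q : ℝ → ℝ} {θ : Measure ℝ} [IsLocallyFiniteMeasure θ]
    {h u v G G' : ℝ → 𝕜} (hS : IsSystem A N q θ h) (huv : IsSolution q θ h u v) {p : ℝ}
    (hp : 2 ≤ p) (hG : HasRNDeriv θ G h)
    (hG' : HasRNDeriv (translateMeasure θ p) G' fun t => h (t + p)) {δ ε η : ℝ}
    (hδ : ∫ r in (-p)..p, ‖G' r - G r‖ ≤ δ)
    (hη : (∫ r in (-p)..p, |q r - q (r + p)|) + A * (∫ r in (-p)..p, ‖G' r - G r‖) ≤ η)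
    (hε : ∀ t, p - 1 ≤ |t| → ‖u t‖ + ‖v t‖ ≤ ε) :
    ∃ c ∈ Icc (0 : ℝ) 1, ‖u c‖ + ‖v c‖ ≤ ε + 2 * (growthConst A κ * Real.exp (κ * 2) *
      (ε + 2 * (growthConst A κ ^ 2 * Real.exp (κ * (p + 1)) *
        (‖u c‖ + ‖v c‖ + ε) * (η + 2 * δ)))) := by
  have := translateMeasure_locallyFinite θ p
  have hS' := hS.translate p
  have hK := growthConst_pos hA hκ
  have hEi : ∀ s t, IntervalIntegrable (fun r => ‖G' r - G r‖) volume s t := by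
    have : ∀ s t, s ≤ t → IntervalIntegrable (fun r => ‖G' r - G r‖) volume s t := by
      intro s t hst
      obtain ⟨B₁, hB₁⟩ := hG'.exists_bound s t
      obtain ⟨B₂, hB₂⟩ := hG.exists_bound s t
      exact (intervalIntegrable_of_bounded (hG'.measurable.sub hG.measurable) hst
        ⟨B₁ + B₂, fun x hx => (norm_sub_le _ _).trans (add_le_add (hB₁ x hx) (hB₂ x hx))⟩).norm
    intro s t
    rcases le_total s t with hst | hst
    · exact this s t hst
    · exact (this t s hst).symm
  have hqi : IntervalIntegrable (fun r => |q r - q (r + p)|) volume (-p) p :=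
    intervalIntegrable_of_bounded (𝕜 := ℝ) (hS.q_measurable.sub hS'.q_measurable).abs
      (by linarith) ⟨A, fun x _ => by
        change |(|q x - q (x + p)|)| ≤ A
        rw [abs_abs, abs_le]
        constructor <;> linarith [hS.q_nonneg x, hS.q_le x, hS.q_nonneg (x + p), hS.q_le (x + p)]⟩
  have hgood : ∀ a, -p ≤ a → a + 1 ≤ p → ∃ c ∈ Icc a (a + 1), ‖G' c - G c‖ ≤ δ := fun a h1 h2 =>
    exists_le_of_integral_le (hEi _ _) ((intervalIntegral.integral_mono_interval h1 (by linarith)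
      h2 (ae_of_all _ fun r => norm_nonneg _) (hEi _ _)).trans hδ)
  have hη' : ∀ r₀ ∈ Icc (-p) p, ∀ r₁ ∈ Icc (-p) p,
      (∫ r in min r₀ r₁..max r₀ r₁, |q r - q (r + p)|) +
      A * (∫ r in min r₀ r₁..max r₀ r₁, ‖G' r - G r‖) ≤ η := by
    intro r₀ hr₀ r₁ hr₁
    refine le_trans (add_le_add ?_ (mul_le_mul_of_nonneg_left ?_ hA.le)) hη
    · exact intervalIntegral.integral_mono_interval (le_min hr₀.1 hr₁.1) min_le_max
        (max_le hr₀.2 hr₁.2) (ae_of_all _ fun r => abs_nonneg _) hqi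
    · exact intervalIntegral.integral_mono_interval (le_min hr₀.1 hr₁.1) min_le_max
        (max_le hr₀.2 hr₁.2) (ae_of_all _ fun r => norm_nonneg _) (hEi _ _)
  obtain ⟨c, hc, hcδ⟩ := hgood 0 (by linarith) (by linarith)
  obtain ⟨b, hb, hbδ⟩ := hgood (p - 1) (by linarith) (by linarith)
  obtain ⟨a, ha, haδ⟩ := hgood (-p) le_rfl (by linarith)
  rw [zero_add] at hc
  rw [sub_add_cancel] at hb
  refine ⟨c, hc, ?_⟩
  have hδ0 : 0 ≤ δ := (norm_nonneg _).trans hcδ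
  have hη0 : 0 ≤ η := le_trans (add_nonneg
    (intervalIntegral.integral_nonneg (by linarith) fun r _ => abs_nonneg _)
    (mul_nonneg hA.le
      (intervalIntegral.integral_nonneg (by linarith) fun r _ => norm_nonneg _))) hη
  have hε0 : 0 ≤ ε := (add_nonneg (norm_nonneg _) (norm_nonneg _)).trans
    (hε p (by rw [abs_of_nonneg (by linarith)]; linarith))
  have hcp : c ∈ Icc (-p) p := ⟨by linarith [hc.1], by linarith [hc.2]⟩
  have hbp : b ∈ Icc (-p) p := ⟨by linarith [hb.1], hb.2⟩
  have hap : a ∈ Icc (-p) p := ⟨ha.1, by linarith [ha.2]⟩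
  -- `(x, y)` continues `M (u, v)(c)` by one block to the right, `(f, g)` takes the value
  -- `M⁻¹ (u, v)(c)` at `c`
  obtain ⟨x, y, hxy, hxc, hyc⟩ := hS.exists_solution c (u (c + p)) (v (c + p))
  obtain ⟨f, g, hfg, hfc, hgc⟩ := hS.exists_solution (c + p) (u c) (v c)
  have hthree := hS.norm_le_three_blocks hfg huv hxy (c := c) (d := c + p) hfc.symm hgc.symm hxc hyc
  have hmid : ‖u (c + p)‖ + ‖v (c + p)‖ ≤ ε :=
    hε _ (by rw [abs_of_nonneg (by linarith [hc.1])]; linarith [hc.1])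
  set F := ‖u c‖ + ‖v c‖ with hF
  have hF0 : 0 ≤ F := by positivity
  set W := growthConst A κ ^ 2 * Real.exp (κ * (p + 1)) * (F + ε) * (η + 2 * δ) with hW
  have hW0 : 0 ≤ W := by positivity
  have hstep : ∀ s t : ℝ, |t - s| ≤ 2 → ∀ {u v : ℝ → 𝕜}, IsSolution q θ h u v → ∀ {B : ℝ},
      ‖u s‖ + ‖v s‖ ≤ B → ‖u t‖ + ‖v t‖ ≤ growthConst A κ * Real.exp (κ * 2) * B := by
    intro s t hst u v huv B hB
    refine (hS.norm_solution_le_exp hA hκ hAN huv s t).trans ?_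
    gcongr
  have hcomp : ∀ r : ℝ, |r - c| ≤ p + 1 → ∀ {B : ℝ}, 0 ≤ B → B ≤ F + ε →
      growthConst A κ ^ 2 * Real.exp (κ * |r - c|) * B * (η + 2 * δ) ≤ W := by
    intro r hr B hB0 hB
    rw [hW]
    gcongr
  -- the block to the right of `c + p`
  have hx : ‖x (c + p)‖ + ‖y (c + p)‖ ≤
      growthConst A κ * Real.exp (κ * 2) * (ε + 2 * W) := by
    refine hstep b (c + p) (by rw [abs_le]; constructor <;> linarith [hb.1, hb.2, hc.1, hc.2])
      hxy ?_
    -- on `[c, b]`, `(u, v)(· + p)` solves the translated system with the same data at `c`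
    have h1 := norm_solution_sub_le hA hκ hAN hS hS' hxy (huv.translate p) hG hG' (r₀ := c)
      (r₁ := b) hxc hyc hcδ hbδ (hη' c hcp b hbp)
    have h2 := hcomp b (by rw [abs_le]; constructor <;> linarith [hb.1, hb.2, hc.1, hc.2])
      (add_nonneg (norm_nonneg (u (c + p))) (norm_nonneg (v (c + p)))) (by linarith)
    have h3 := hε (b + p) (by rw [abs_of_nonneg (by linarith [hb.1])]; linarith [hb.1])
    have h4 := norm_add_le (x b - u (b + p)) (u (b + p))
    have h5 := norm_add_le (y b - v (b + p)) (v (b + p))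
    rw [sub_add_cancel] at h4 h5
    linarith
  -- the block to the left of `c`
  have hf : ‖f c‖ + ‖g c‖ ≤ growthConst A κ * Real.exp (κ * 2) * (ε + 2 * W) := by
    refine hstep (a + p) c
      (by rw [abs_le]; constructor <;> linarith [ha.1, ha.2, hc.1, hc.2]) hfg ?_
    -- on `[a, c]`, `(f, g)(· + p)` solves the translated system, with the data of `(u, v)` at `c`
    have h1 := norm_solution_sub_le hA hκ hAN hS hS' huv (hfg.translate p) hG hG' (r₀ := c)
      (r₁ := a) hfc.symm hgc.symm hcδ haδ (hη' c hcp a hap)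
    have h2 := hcomp a (by rw [abs_le]; constructor <;> linarith [ha.1, ha.2, hc.1, hc.2])
      (add_nonneg (norm_nonneg (f (c + p))) (norm_nonneg (g (c + p))))
      (by rw [hfc, hgc]; linarith)
    have h3 := hε a (by rw [abs_of_nonpos (by linarith [ha.2])]; linarith [ha.2])
    have h4 := norm_sub_le (u a) (u a - f (a + p))
    have h5 := norm_sub_le (v a) (v a - g (a + p))
    rw [sub_sub_cancel] at h4 h5
    linarith
  linarith

end ThreeBlocks

/-! ### The eigenvalue equation as a first order system -/

section Reduction

variable {𝕜 : Type*} [RCLike 𝕜]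

/-- The measure `|μ| + |z| ρ`, with respect to which `μ - z ρ` has a density bounded by one. -/
noncomputable def dominatingMeasure (μ : RealLocalMeasure) (ρ : Measure ℝ) (z : 𝕜) : Measure ℝ :=
  μ.variation + ‖z‖₊ • ρ

theorem dominatingMeasure_locallyFinite (μ : RealLocalMeasure) (ρ : Measure ℝ)
    [IsLocallyFiniteMeasure ρ] (z : 𝕜) : IsLocallyFiniteMeasure (dominatingMeasure μ ρ z) := by
  have := μ.pos_locallyFinite
  have := μ.neg_locallyFinite
  refine ⟨fun x => ?_⟩
  obtain ⟨U₁, h₁, f₁⟩ := μ.pos.exists_isOpen_measure_lt_top x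
  obtain ⟨U₂, h₂, f₂⟩ := μ.neg.exists_isOpen_measure_lt_top x
  obtain ⟨U₃, h₃, f₃⟩ := ρ.exists_isOpen_measure_lt_top x
  refine ⟨U₁ ∩ U₂ ∩ U₃, inter_mem (inter_mem (f₁.1.mem_nhds h₁) (f₂.1.mem_nhds h₂))
    (f₃.1.mem_nhds h₃), ?_⟩
  have e₁ : μ.pos (U₁ ∩ U₂ ∩ U₃) < ∞ :=
    (measure_mono fun x hx => hx.1.1).trans_lt f₁.2
  have e₂ : μ.neg (U₁ ∩ U₂ ∩ U₃) < ∞ :=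
    (measure_mono fun x hx => hx.1.2).trans_lt f₂.2
  have e₃ : ρ (U₁ ∩ U₂ ∩ U₃) < ∞ := (measure_mono fun x hx => hx.2).trans_lt f₃.2
  simp only [dominatingMeasure, RealLocalMeasure.variation, Measure.add_apply, Measure.smul_apply]
  exact ENNReal.add_lt_top.2 ⟨ENNReal.add_lt_top.2 ⟨e₁, e₂⟩, ENNReal.mul_lt_top (by simp) e₃⟩

/-- The complex measure `μ - z ρ` as a density of modulus at most one times a positive measure. -/
theorem exists_density (μ : RealLocalMeasure) (ρ : Measure ℝ) [IsLocallyFiniteMeasure ρ] (z : 𝕜) :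
    ∃ h : ℝ → 𝕜, Measurable h ∧ (∀ t, ‖h t‖ ≤ 1) ∧ ∀ u : ℝ → 𝕜, Continuous u → ∀ s t,
      ∫ x in s..t, h x * u x ∂dominatingMeasure μ ρ z =
        μ.integralBetween u s t - z * ∫ x in s..t, u x ∂ρ := by
  have := μ.pos_locallyFinite
  have := μ.neg_locallyFinite
  have := dominatingMeasure_locallyFinite μ ρ z
  set θ := dominatingMeasure μ ρ z with hθ
  have hle : μ.pos + μ.neg + ‖z‖₊ • ρ = θ := rfl
  have hsf : SigmaFinite (‖z‖₊ • ρ) := inferInstance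
  have ac₁ : μ.pos ≪ θ := Measure.absolutelyContinuous_of_le (by
    rw [← hle, add_assoc]; exact Measure.le_add_right le_rfl)
  have ac₂ : μ.neg ≪ θ := Measure.absolutelyContinuous_of_le (by
    rw [← hle]; exact Measure.le_add_right (Measure.le_add_left le_rfl))
  have ac₃ : ‖z‖₊ • ρ ≪ θ := Measure.absolutelyContinuous_of_le (by
    rw [← hle]; exact Measure.le_add_left le_rfl)
  set f₁ : ℝ → ℝ := fun x => (μ.pos.rnDeriv θ x).toReal with hf₁
  set f₂ : ℝ → ℝ := fun x => (μ.neg.rnDeriv θ x).toReal with hf₂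
  set f₃ : ℝ → ℝ := fun x => ((‖z‖₊ • ρ).rnDeriv θ x).toReal with hf₃
  have m₁ : Measurable f₁ := (Measure.measurable_rnDeriv _ _).ennreal_toReal
  have m₂ : Measurable f₂ := (Measure.measurable_rnDeriv _ _).ennreal_toReal
  have m₃ : Measurable f₃ := (Measure.measurable_rnDeriv _ _).ennreal_toReal
  have n₁ : ∀ x, 0 ≤ f₁ x := fun x => ENNReal.toReal_nonneg
  have n₂ : ∀ x, 0 ≤ f₂ x := fun x => ENNReal.toReal_nonneg
  have n₃ : ∀ x, 0 ≤ f₃ x := fun x => ENNReal.toReal_nonneg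
  have hsum : ∀ᵐ x ∂θ, f₁ x + f₂ x + f₃ x = 1 := by
    have a₁ := Measure.rnDeriv_add' (μ.pos + μ.neg) (‖z‖₊ • ρ) θ
    have a₂ := Measure.rnDeriv_add' μ.pos μ.neg θ
    rw [hle] at a₁
    filter_upwards [a₁, a₂, Measure.rnDeriv_self θ, Measure.rnDeriv_lt_top μ.pos θ,
      Measure.rnDeriv_lt_top μ.neg θ, Measure.rnDeriv_lt_top (‖z‖₊ • ρ) θ] with x h₁ h₂ h₃ l₁ l₂ l₃
    rw [h₃, Pi.add_apply, h₂, Pi.add_apply] at h₁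
    simp only [hf₁, hf₂, hf₃]
    rw [← ENNReal.toReal_add l₁.ne l₂.ne, ← ENNReal.toReal_add (ENNReal.add_lt_top.2 ⟨l₁, l₂⟩).ne
      l₃.ne, ← h₁, ENNReal.toReal_one]
  -- for `z = 0` this is `ζ = 0`, as required
  set ζ : 𝕜 := z / ‖z‖ with hζ
  have hζ1 : ‖ζ‖ ≤ 1 := by
    rw [hζ, norm_div, RCLike.norm_ofReal, abs_norm]
    exact div_self_le_one _
  have hζz : ζ * ‖z‖ = z := by
    by_cases h : z = 0
    · simp [h]
    · rw [hζ, div_mul_cancel₀]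
      exact_mod_cast norm_ne_zero_iff.2 h
  set g : ℝ → 𝕜 := fun x => (f₁ x : 𝕜) - f₂ x - ζ * f₃ x with hg
  have hgm : Measurable g := ((RCLike.measurable_ofReal.comp m₁).sub
    (RCLike.measurable_ofReal.comp m₂)).sub ((RCLike.measurable_ofReal.comp m₃).const_mul ζ)
  have hg1 : ∀ᵐ x ∂θ, ‖g x‖ ≤ 1 := by
    filter_upwards [hsum] with x hx
    calc ‖g x‖ ≤ ‖(f₁ x : 𝕜)‖ + ‖(f₂ x : 𝕜)‖ + ‖ζ * f₃ x‖ :=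
          (norm_sub_le _ _).trans (add_le_add_left (norm_sub_le _ _) _)
      _ ≤ f₁ x + f₂ x + f₃ x := by
          rw [norm_mul, RCLike.norm_ofReal, RCLike.norm_ofReal, RCLike.norm_ofReal,
            abs_of_nonneg (n₁ x), abs_of_nonneg (n₂ x), abs_of_nonneg (n₃ x)]
          exact add_le_add_right (mul_le_of_le_one_left (n₃ x) hζ1) _
      _ = 1 := hx
  set h : ℝ → 𝕜 := fun x => if ‖g x‖ ≤ 1 then g x else 0 with hh
  have hhg : h =ᵐ[θ] g := by
    filter_upwards [hg1] with x hx
    simp [hh, hx]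
  refine ⟨h, Measurable.ite (measurableSet_le hgm.norm measurable_const) hgm measurable_const,
    fun t => ?_, fun u hu s t => ?_⟩
  · simp only [hh]
    split_ifs with ht
    · exact ht
    · simp
  have key : ∀ s t, ∫ x in Ioc s t, h x * u x ∂θ =
      (∫ x in Ioc s t, u x ∂μ.pos) - (∫ x in Ioc s t, u x ∂μ.neg) -
        z * ∫ x in Ioc s t, u x ∂ρ := by
    intro s t
    have hui : IntegrableOn u (Ioc s t) θ :=
      (hu.locallyIntegrable.integrableOn_isCompact isCompact_Icc).mono_set Ioc_subset_Icc_self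
    have hi : ∀ f : ℝ → ℝ, Measurable f → (∀ᵐ x ∂θ, |f x| ≤ 1) →
        IntegrableOn (fun x => f x • u x) (Ioc s t) θ := by
      intro f hf hf1
      refine Integrable.mono hui (hf.aestronglyMeasurable.smul hu.aestronglyMeasurable) ?_
      filter_upwards [ae_restrict_of_ae hf1] with x hx
      rw [norm_smul]
      exact mul_le_of_le_one_left (norm_nonneg _) hx
    have i₁ := hi f₁ m₁ (by
      filter_upwards [hsum] with x hx
      rw [abs_of_nonneg (n₁ x)]; linarith [n₂ x, n₃ x])
    have i₂ := hi f₂ m₂ (by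
      filter_upwards [hsum] with x hx
      rw [abs_of_nonneg (n₂ x)]; linarith [n₁ x, n₃ x])
    have i₃ := hi f₃ m₃ (by
      filter_upwards [hsum] with x hx
      rw [abs_of_nonneg (n₃ x)]; linarith [n₁ x, n₂ x])
    have e : ∫ x in Ioc s t, h x * u x ∂θ =
        ∫ x in Ioc s t, (f₁ x • u x - f₂ x • u x - ζ * (f₃ x • u x)) ∂θ := by
      refine integral_congr_ae ?_
      filter_upwards [ae_restrict_of_ae hhg] with x hx
      rw [hx]
      simp only [hg, RCLike.real_smul_eq_coe_mul]
      ring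
    have i₁₂ : IntegrableOn (fun x => f₁ x • u x - f₂ x • u x) (Ioc s t) θ := i₁.sub i₂
    rw [e, integral_sub i₁₂ (i₃.const_mul ζ), integral_sub i₁ i₂, integral_const_mul,
      setIntegral_rnDeriv_smul ac₁ measurableSet_Ioc,
      setIntegral_rnDeriv_smul ac₂ measurableSet_Ioc,
      setIntegral_rnDeriv_smul ac₃ measurableSet_Ioc]
    congr 1
    rw [Measure.restrict_smul, integral_smul_nnreal_measure, NNReal.smul_def, coe_nnnorm,
      RCLike.real_smul_eq_coe_mul, ← mul_assoc, hζz]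
  simp only [intervalIntegral, RealLocalMeasure.integralBetween, key]
  ring

theorem HasRNDeriv.congr_ae {ν : Measure ℝ} {f h h' : ℝ → 𝕜} (hf : HasRNDeriv ν f h)
    (hh : h =ᵐ[ν] h') : HasRNDeriv ν f h' := by
  refine ⟨hf.1.congr hh, ?_⟩
  obtain ⟨c, hc⟩ := hf.2
  refine ⟨c, fun t => ?_⟩
  rw [hc t]
  congr 1
  exact intervalIntegral.integral_congr_ae (by filter_upwards [hh] with x hx _ using hx)

/-- A bounded and bounded below representative of `1 / a`. -/
theorem IsAM.exists_representative {ρ : Measure ℝ} {a : ℝ → ℝ} {μ : RealLocalMeasure}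
    (h : IsAM ρ a μ) :
    ∃ (q : ℝ → ℝ) (q₀ : ℝ), Measurable q ∧ 0 < q₀ ∧ (∀ t, q₀ ≤ q t) ∧
      (∀ t, q t ≤ (eLpNorm (fun t => 1 / a t) ⊤ volume).toReal) ∧
      q =ᵐ[volume] fun t => 1 / a t := by
  have bound : ∀ f : ℝ → ℝ, MemLp f ∞ volume → ∀ᵐ t, |f t| ≤ (eLpNorm f ∞ volume).toReal := by
    intro f hf
    have h1 := ae_le_eLpNormEssSup (f := f) (μ := volume)
    filter_upwards [h1] with t ht
    rw [← eLpNorm_exponent_top] at ht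
    have := ENNReal.toReal_mono hf.eLpNorm_lt_top.ne ht
    simpa using this
  set A := (eLpNorm (fun t => 1 / a t) ∞ volume).toReal with hA
  set B := (eLpNorm a ∞ volume).toReal with hB
  have hm := h.inv_a_bounded.aestronglyMeasurable
  set k := hm.mk _ with hk
  have hae : ∀ᵐ t, 0 < a t ∧ |1 / a t| ≤ A ∧ |a t| ≤ B ∧ 1 / a t = k t := by
    filter_upwards [h.a_pos, bound _ h.inv_a_bounded, bound _ h.a_bounded, hm.ae_eq_mk]
      with t h1 h2 h3 h4 using ⟨h1, h2, h3, h4⟩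
  have hpt : ∀ t, 0 < a t → |1 / a t| ≤ A → |a t| ≤ B → 0 < B ∧ 1 / B ≤ 1 / a t ∧ 1 / a t ≤ A := by
    intro t h1 h2 h3
    rw [abs_of_pos h1] at h3
    exact ⟨h1.trans_le h3, one_div_le_one_div_of_le h1 h3, (le_abs_self _).trans h2⟩
  obtain ⟨t₀, h1, h2, h3, -⟩ := hae.exists
  obtain ⟨hB0, hBa, haA⟩ := hpt t₀ h1 h2 h3
  refine ⟨fun t => max (1 / B) (min A (k t)), 1 / B,
    measurable_const.max (measurable_const.min hm.stronglyMeasurable_mk.measurable), by positivity,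
    fun t => le_max_left _ _, fun t => max_le (hBa.trans haA) (min_le_left _ _), ?_⟩
  filter_upwards [hae] with t ht
  obtain ⟨-, l₁, l₂⟩ := hpt t ht.1 ht.2.1 ht.2.2.1
  rw [← ht.2.2.2, min_eq_right l₂, max_eq_right l₁]

/-- The eigenvalue equation as a system: `v = -w + ∫_0^t u dμ`, where `w` is the representative of
`A_{a,μ} u`, agrees almost everywhere with `a u'`. -/
theorem isSolution_of_hasSLImage {ρ : Measure ℝ} [IsLocallyFiniteMeasure ρ] {a : ℝ → ℝ}
    {μ : RealLocalMeasure} {z : 𝕜} {q : ℝ → ℝ} {h u g : ℝ → 𝕜}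
    (ha : ∀ᵐ t ∂volume, 0 < a t) (hq : q =ᵐ[volume] fun t => 1 / a t)
    (hm : Measurable h) (hh1 : ∀ t, ‖h t‖ ≤ 1)
    (hh : ∀ u : ℝ → 𝕜, Continuous u → ∀ s t,
      ∫ x in s..t, h x * u x ∂dominatingMeasure μ ρ z =
        μ.integralBetween u s t - z * ∫ x in s..t, u x ∂ρ)
    (hg : g =ᵐ[ρ] fun t => z * u t) (hu : HasSLImage ρ a μ u g) :
    ∃ v, IsSolution q (dominatingMeasure μ ρ z) h u v := by
  have := μ.pos_locallyFinite
  have := μ.neg_locallyFinite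
  have := dominatingMeasure_locallyFinite μ ρ z
  obtain ⟨u', w, hu', hw, hwg⟩ := hu
  have huc := hu'.continuous
  have hwg := hwg.congr_ae hg
  have hbet : ∀ s t, μ.integralBetween u 0 t - μ.integralBetween u 0 s =
      μ.integralBetween u s t := by
    intro s t
    simp only [RealLocalMeasure.integralBetween]
    rw [← intervalIntegral.integral_interval_sub_left (huc.intervalIntegrable 0 t)
      (huc.intervalIntegrable 0 s),
      ← intervalIntegral.integral_interval_sub_left (huc.intervalIntegrable 0 t)
      (huc.intervalIntegrable 0 s)]
    ring
  refine ⟨fun t => -w t + μ.integralBetween u 0 t, hu'.congr_ae ?_, HasRNDeriv.of_sub_eq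
    fun s t hst => ⟨?_, ?_⟩⟩
  · filter_upwards [ha, hq, hw] with t h1 h2 h3
    have h4 : (a t : 𝕜) ≠ 0 := by exact_mod_cast h1.ne'
    rw [h3, h2, slPrimitive]
    push_cast
    field_simp
    ring
  · have hui : LocallyIntegrable u (dominatingMeasure μ ρ z) := huc.locallyIntegrable
    have : LocallyIntegrable (fun t => h t * u t) (dominatingMeasure μ ρ z) := by
      refine hui.mono (hm.aestronglyMeasurable.mul huc.aestronglyMeasurable)
        (ae_of_all _ fun x => ?_)
      rw [norm_mul]
      exact mul_le_of_le_one_left (norm_nonneg _) (hh1 x)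
    exact (this.integrableOn_isCompact isCompact_uIcc).intervalIntegrable
  · have e := hwg.sub_eq s t
    rw [intervalIntegral.integral_const_mul] at e
    rw [hh u huc s t, ← hbet s t]
    linear_combination -e

theorem dominatingMeasure_Ioc_le (μ : RealLocalMeasure) (ρ : Measure ℝ) (z : 𝕜)
    (hμ : unifNorm μ.variation < ∞) (hρ : unifNorm ρ < ∞) (t : ℝ) :
    dominatingMeasure μ ρ z (Ioc t (t + 1)) ≤
      ENNReal.ofReal ((unifNorm μ.variation).toReal + ‖z‖ * (unifNorm ρ).toReal) := by
  rw [ENNReal.ofReal_add ENNReal.toReal_nonneg (by positivity), ENNReal.ofReal_mul (norm_nonneg _),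
    ENNReal.ofReal_toReal hμ.ne, ENNReal.ofReal_toReal hρ.ne, dominatingMeasure,
    Measure.add_apply, Measure.smul_apply]
  refine add_le_add (le_iSup (fun t => μ.variation (Ioc t (t + 1))) t) ?_
  rw [ENNReal.smul_def, smul_eq_mul, ofReal_norm, enorm_eq_nnnorm]
  gcongr
  exact le_iSup (fun t => ρ (Ioc t (t + 1))) t

theorem dominatingMeasure_compl_support (μ : RealLocalMeasure) (ρ : Measure ℝ) (z : 𝕜)
    (h : μ.variation.support ⊆ ρ.support) : dominatingMeasure μ ρ z ρ.supportᶜ = 0 := by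
  have h1 : μ.variation ρ.supportᶜ = 0 :=
    measure_mono_null (compl_subset_compl.2 h) Measure.measure_compl_support
  have h2 : ρ ρ.supportᶜ = 0 := Measure.measure_compl_support
  rw [dominatingMeasure, Measure.add_apply, Measure.smul_apply, h1, h2]
  simp

end Reduction

/-! ### Absence of eigenvalues -/

section Main

variable {𝕜 : Type*} [RCLike 𝕜]

/-- The primitives of `μ - z ρ` and of its translate by a period of `ρ` differ by the primitive of
`μ(· + p) - μ`. -/
theorem integral_density_translate_sub {ρ : Measure ℝ} [IsLocallyFiniteMeasure ρ]
    {μ : RealLocalMeasure} {z : 𝕜} {h : ℝ → 𝕜} {p : ℝ} (hp : translateMeasure ρ p = ρ)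
    (hh : ∀ u : ℝ → 𝕜, Continuous u → ∀ s t,
      ∫ x in s..t, h x * u x ∂dominatingMeasure μ ρ z =
        μ.integralBetween u s t - z * ∫ x in s..t, u x ∂ρ) (t : ℝ) :
    (∫ x in (0 : ℝ)..t, h (x + p) ∂translateMeasure (dominatingMeasure μ ρ z) p) -
      (∫ x in (0 : ℝ)..t, h x ∂dominatingMeasure μ ρ z) =
      (((μ.translate p).cdf t - μ.cdf t : ℝ) : 𝕜) := by
  have hone : ∀ s t, ∫ x in s..t, h x ∂dominatingMeasure μ ρ z =
      μ.integralBetween (fun _ => (1 : 𝕜)) s t - z * ∫ x in s..t, (1 : 𝕜) ∂ρ := by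
    intro s t
    simpa using hh (fun _ => 1) continuous_const s t
  have hcast : ∀ ν : Measure ℝ, ∀ s t, ∫ x in s..t, (1 : 𝕜) ∂ν =
      ((∫ x in s..t, (1 : ℝ) ∂ν : ℝ) : 𝕜) := by
    intro ν s t
    have : ∀ S : Set ℝ, ∫ x in S, (1 : 𝕜) ∂ν = ((∫ x in S, (1 : ℝ) ∂ν : ℝ) : 𝕜) := by
      intro S
      rw [← integral_ofReal]
      simp
    simp only [intervalIntegral, this, RCLike.ofReal_sub]
  have htr : ∀ ν : Measure ℝ, ∫ x in (0 : ℝ)..t, (1 : ℝ) ∂translateMeasure ν p =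
      ∫ x in (0 + p)..(t + p), (1 : ℝ) ∂ν := fun ν =>
    intervalIntegral_translateMeasure ν (fun _ => (1 : ℝ)) p 0 t
  have hρ := htr ρ
  rw [hp] at hρ
  rw [intervalIntegral_translateMeasure, hone, hone]
  simp only [RealLocalMeasure.cdf, RealLocalMeasure.integralBetween, RealLocalMeasure.translate,
    hcast, htr, hρ]
  push_cast
  ring

theorem integral_abs_sub_translate_le {a q : ℝ → ℝ} {A p L : ℝ} (hL : 0 ≤ L) (hp : 0 ≤ p)
    (ha : ∀ᵐ t ∂volume, 0 < a t) (hqm : Measurable q) (hq0 : ∀ t, 0 ≤ q t) (hqA : ∀ t, q t ≤ A)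
    (hq : q =ᵐ[volume] fun t => 1 / a t)
    (h : eLpNorm (fun t => a t - a (t + p)) 1 (volume.restrict (Ioo (-p) p)) ≤ ENNReal.ofReal L) :
    ∫ r in (-p)..p, |q r - q (r + p)| ≤ A ^ 2 * L := by
  have hqm' : Measurable fun r => |q r - q (r + p)| :=
    (hqm.sub (hqm.comp (measurable_id.add_const p))).abs
  have hqmp := (measurePreserving_add_right (volume : Measure ℝ) p).quasiMeasurePreserving
  rw [eLpNorm_one_eq_lintegral_enorm] at h
  rw [intervalIntegral.integral_of_le (by linarith), integral_Ioc_eq_integral_Ioo,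
    integral_eq_lintegral_of_nonneg_ae (ae_of_all _ fun r => abs_nonneg _)
      hqm'.aestronglyMeasurable]
  refine ENNReal.toReal_le_of_le_ofReal (by positivity) ?_
  rw [ENNReal.ofReal_mul (by positivity)]
  refine le_trans ?_ (mul_le_mul_right h _)
  rw [← lintegral_const_mul' _ _ ENNReal.ofReal_ne_top]
  refine lintegral_mono_ae (ae_restrict_of_ae ?_)
  filter_upwards [ha, hq, hqmp.ae ha, hqmp.ae hq] with t h1 h2 h3 h4
  rw [← ofReal_norm, ← ENNReal.ofReal_mul (by positivity)]
  refine ENNReal.ofReal_le_ofReal ?_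
  have e : q t - q (t + p) = -(q t * q (t + p) * (a t - a (t + p))) := by
    rw [h2, h4]
    have := h1.ne'
    have := h3.ne'
    field_simp
    ring
  rw [e, abs_neg, abs_mul, abs_of_nonneg (mul_nonneg (hq0 _) (hq0 _)), Real.norm_eq_abs, sq]
  exact mul_le_mul_of_nonneg_right
    (mul_le_mul (hqA _) (hqA _) (hq0 _) ((hq0 t).trans (hqA t))) (abs_nonneg _)

/-- The polynomial factor is absorbed by the gap between the rates `κ` and `C`. -/
theorem exp_mul_sq_le {κ C p : ℝ} (hκC : κ < C) (hp : 0 ≤ p) :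
    Real.exp (κ * p) * (p + 1) ^ 2 ≤ ((min 1 ((C - κ) / 2)) ^ 2)⁻¹ * Real.exp (C * p) := by
  have hb : 0 < C - κ := by linarith
  set m := min 1 ((C - κ) / 2) with hm
  have hm0 : 0 < m := by positivity
  have h1 : m * (p + 1) ≤ Real.exp ((C - κ) / 2 * p) := by
    refine le_trans ?_ (Real.add_one_le_exp _)
    have h2 : m ≤ 1 := min_le_left _ _
    have h3 : m * p ≤ (C - κ) / 2 * p := mul_le_mul_of_nonneg_right (min_le_right _ _) hp
    linarith
  have h2 : (m * (p + 1)) ^ 2 ≤ Real.exp ((C - κ) * p) := by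
    refine (pow_le_pow_left₀ (by positivity) h1 2).trans_eq ?_
    rw [← Real.exp_nat_mul]
    congr 1
    push_cast
    ring
  have h3 : Real.exp (C * p) = Real.exp (κ * p) * Real.exp ((C - κ) * p) := by
    rw [← Real.exp_add]; ring_nf
  rw [← div_eq_inv_mul, le_div_iff₀ (by positivity), h3]
  calc Real.exp (κ * p) * (p + 1) ^ 2 * m ^ 2 = Real.exp (κ * p) * (m * (p + 1)) ^ 2 := by ring
    _ ≤ _ := by gcongr

/-- Under the weak Gordon condition, `κ < C` and `A N ≤ κ²` rule out solutions that tend to zero at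
infinity, other than the trivial one. -/
theorem IsSystem.solution_eq_zero_of_weakGordonAlong {A N κ C : ℝ} (hA : 0 < A) (hκ : 0 < κ)
    (hκC : κ < C) (hAN : A * N ≤ κ ^ 2) {ρ : Measure ℝ} [IsLocallyFiniteMeasure ρ]
    {a q : ℝ → ℝ} {μ : RealLocalMeasure} {z : 𝕜} {h u v : ℝ → 𝕜} {per : ℕ → ℝ}
    (hper : ∀ m, translateMeasure ρ (per m) = ρ) (hG : WeakGordonAlong a μ C per)
    (ha : ∀ᵐ t ∂volume, 0 < a t) (hq : q =ᵐ[volume] fun t => 1 / a t)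
    (hS : IsSystem A N q (dominatingMeasure μ ρ z) h)
    (hh : ∀ u : ℝ → 𝕜, Continuous u → ∀ s t,
      ∫ x in s..t, h x * u x ∂dominatingMeasure μ ρ z =
        μ.integralBetween u s t - z * ∫ x in s..t, u x ∂ρ)
    (huv : IsSolution q (dominatingMeasure μ ρ z) h u v)
    (hdecay : ∀ ε > 0, ∃ R, ∀ t, R ≤ |t| → ‖u t‖ + ‖v t‖ ≤ ε) (t : ℝ) : u t = 0 := by
  have := dominatingMeasure_locallyFinite μ ρ z
  set K := growthConst A κ with hK
  have hK0 : 0 < K := growthConst_pos hA hκ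
  set F₀ := ‖u 0‖ + ‖v 0‖ with hF₀
  suffices hF : F₀ = 0 by
    have := hS.norm_solution_le_exp hA hκ hAN huv 0 t
    rw [← hF₀, hF, mul_zero] at this
    exact norm_le_zero_iff.1 (by linarith [norm_nonneg (v t)])
  by_contra hne
  have hF0 : 0 < F₀ := lt_of_le_of_ne (by positivity) (Ne.symm hne)
  set E₁ := K * Real.exp κ with hE₁
  set E₂ := K * Real.exp (κ * 2) with hE₂
  have hE₁0 : 0 < E₁ := by positivity
  have hE₂0 : 0 < E₂ := by positivity
  -- the bound below will read `F₀ ≤ E₁ (1 + 4 E₂) ε`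
  set ε := min 1 (F₀ / (2 * (E₁ * (1 + 4 * E₂)))) with hε
  have hε0 : 0 < ε := by positivity
  have hε1 : ε ≤ 1 := min_le_left _ _
  have hεF : E₁ * (1 + 4 * E₂) * ε ≤ F₀ / 2 := by
    calc _ ≤ E₁ * (1 + 4 * E₂) * (F₀ / (2 * (E₁ * (1 + 4 * E₂)))) := by
          gcongr; exact min_le_right _ _
      _ = _ := by field_simp
  set F₁ := E₁ * F₀ with hF₁
  have hF₁0 : 0 < F₁ := by positivity
  set M := A ^ 2 + 32 * A + 64 with hM
  have hM0 : 0 < M := by positivity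
  -- the size of `exp (κ p)` times the perturbation that keeps the comparison error below `ε`
  set ω := ε / (2 * (K ^ 2 * Real.exp κ * (F₁ + 1))) with hω
  have hω0 : 0 < ω := by positivity
  obtain ⟨R, hR⟩ := hdecay ε hε0
  set Λ : ℕ → ℝ≥0∞ := fun m =>
    eLpNorm (fun t => a t - a (t + per m)) 1 (volume.restrict (Ioo (-per m) (per m))) +
      seminormSub (Icc (-per m) (per m)) μ (μ.translate (per m)) with hΛ
  have hlim : Tendsto (fun m => ENNReal.ofReal (Real.exp (C * per m)) * Λ m) atTop (𝓝 0) :=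
    hG.tendsto_zero
  set m₀ := ((min 1 ((C - κ) / 2)) ^ 2)⁻¹ with hm₀
  have hm₀0 : 0 < m₀ := by
    have : 0 < C - κ := by linarith
    positivity
  obtain ⟨m, hm1, hm2, hm3⟩ := ((hlim.eventually_lt_const
    (ENNReal.ofReal_pos.2 (show 0 < ω / (m₀ * M) by positivity))).and
    ((hG.per_tendsto.eventually_ge_atTop 2).and
      (hG.per_tendsto.eventually_ge_atTop (R + 1)))).exists
  set p := per m with hp
  have hp0 : 0 < p := by linarith
  have hfin : Λ m ≠ ∞ := by
    intro htop
    rw [htop, ENNReal.mul_top (ENNReal.ofReal_pos.2 (Real.exp_pos _)).ne'] at hm1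
    exact not_top_lt hm1
  set S := (Λ m).toReal with hS'
  have hS0 : 0 ≤ S := ENNReal.toReal_nonneg
  have hΛS : Λ m = ENNReal.ofReal S := (ENNReal.ofReal_toReal hfin).symm
  have hexpS : Real.exp (C * p) * S ≤ ω / (m₀ * M) := by
    rw [hΛS, ← ENNReal.ofReal_mul (Real.exp_pos _).le] at hm1
    exact ((ENNReal.ofReal_lt_ofReal_iff (by positivity)).1 hm1).le
  have hL : eLpNorm (fun t => a t - a (t + p)) 1 (volume.restrict (Ioo (-p) p)) ≤
      ENNReal.ofReal S := by rw [← hΛS]; exact le_self_add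
  have hsemi : seminormSub (Icc (-p) p) μ (μ.translate p) ≤ ENNReal.ofReal S := by
    rw [← hΛS]; exact le_add_self
  obtain ⟨k, hk⟩ := exists_integral_abs_cdf_sub_le (by linarith) hS0 hsemi
  have hqL := integral_abs_sub_translate_le hS0 hp0.le ha hS.q_measurable hS.q_nonneg hS.q_le hq hL
  have hloc : ∀ {N : ℝ} {q : ℝ → ℝ} {θ : Measure ℝ} [IsLocallyFiniteMeasure θ] {h : ℝ → 𝕜},
      IsSystem A N q θ h → LocallyIntegrable h θ := by
    intro N q θ _ h hS
    exact (locallyIntegrable_const (1 : ℝ)).mono hS.h_measurable.aestronglyMeasurable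
      (ae_of_all _ fun x => by simpa using hS.h_le x)
  have := translateMeasure_locallyFinite (dominatingMeasure μ ρ z) p
  set G : ℝ → 𝕜 := fun t => (k : 𝕜) + ∫ x in (0 : ℝ)..t, h x ∂dominatingMeasure μ ρ z with hGdef
  set G' : ℝ → 𝕜 := fun t =>
    ∫ x in (0 : ℝ)..t, h (x + p) ∂translateMeasure (dominatingMeasure μ ρ z) p with hG'def
  have hGd : HasRNDeriv (dominatingMeasure μ ρ z) G h := ⟨hloc hS, 0, fun t => by simp [hGdef]⟩
  have hGd' : HasRNDeriv (translateMeasure (dominatingMeasure μ ρ z) p) G' fun t => h (t + p) :=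
    ⟨hloc (hS.translate p), 0, fun t => by simp [hG'def]⟩
  have hGG : ∀ r, ‖G' r - G r‖ = |(μ.translate p).cdf r - μ.cdf r - k| := by
    intro r
    have e := integral_density_translate_sub (hper m) hh r
    rw [← RCLike.norm_ofReal (K := 𝕜), RCLike.ofReal_sub, ← e]
    simp only [hGdef, hG'def]
    congr 1
    ring
  have hδ : ∫ r in (-p)..p, ‖G' r - G r‖ ≤ 32 * (p + 1) ^ 2 * S := by simpa only [hGG] using hk
  obtain ⟨c, hc, hFc⟩ := hS.norm_solution_le_of_almost_periodic hA hκ hAN huv hm2 hGd hGd' hδ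
    (add_le_add hqL (mul_le_mul_of_nonneg_left hδ hA.le))
    (fun t ht => hR t (by linarith))
  set F := ‖u c‖ + ‖v c‖ with hF
  have hcabs : |c| ≤ 1 := by rw [abs_of_nonneg hc.1]; exact hc.2
  have hexpc : Real.exp (κ * |c|) ≤ Real.exp κ :=
    Real.exp_le_exp.2 (mul_le_of_le_one_right hκ.le hcabs)
  have hFF₁ : F ≤ F₁ := by
    refine (hS.norm_solution_le_exp hA hκ hAN huv 0 c).trans ?_
    rw [sub_zero, hF₁, hE₁]
    gcongr
  have hF₀F : F₀ ≤ E₁ * F := by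
    refine (hS.norm_solution_le_exp hA hκ hAN huv c 0).trans ?_
    rw [zero_sub, abs_neg, hE₁]
    gcongr
  have hη : A ^ 2 * S + A * (32 * (p + 1) ^ 2 * S) + 2 * (32 * (p + 1) ^ 2 * S) ≤
      M * ((p + 1) ^ 2 * S) := by
    have : A ^ 2 * S * 1 ≤ A ^ 2 * S * (p + 1) ^ 2 := by
      gcongr; nlinarith
    rw [hM]; linarith
  have hexpη : Real.exp (κ * p) *
      (A ^ 2 * S + A * (32 * (p + 1) ^ 2 * S) + 2 * (32 * (p + 1) ^ 2 * S)) ≤ ω := by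
    calc _ ≤ Real.exp (κ * p) * (M * ((p + 1) ^ 2 * S)) := by gcongr
      _ = Real.exp (κ * p) * (p + 1) ^ 2 * (M * S) := by ring
      _ ≤ m₀ * Real.exp (C * p) * (M * S) :=
          mul_le_mul_of_nonneg_right (exp_mul_sq_le hκC hp0.le) (by positivity)
      _ = m₀ * M * (Real.exp (C * p) * S) := by ring
      _ ≤ m₀ * M * (ω / (m₀ * M)) := by gcongr
      _ = ω := by field_simp
  have hW : 2 * (K ^ 2 * Real.exp (κ * (p + 1)) * (F + ε) *
      (A ^ 2 * S + A * (32 * (p + 1) ^ 2 * S) + 2 * (32 * (p + 1) ^ 2 * S))) ≤ ε := by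
    have hexp : Real.exp (κ * (p + 1)) = Real.exp (κ * p) * Real.exp κ := by
      rw [← Real.exp_add]; ring_nf
    rw [hexp]
    set T := A ^ 2 * S + A * (32 * (p + 1) ^ 2 * S) + 2 * (32 * (p + 1) ^ 2 * S)
    calc 2 * (K ^ 2 * (Real.exp (κ * p) * Real.exp κ) * (F + ε) * T)
        = 2 * (K ^ 2 * Real.exp κ * (F + ε)) * (Real.exp (κ * p) * T) := by ring
      _ ≤ 2 * (K ^ 2 * Real.exp κ * (F₁ + 1)) * ω := by gcongr
      _ = ε := by rw [hω]; field_simp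
  have hFε : F ≤ (1 + 4 * E₂) * ε := by
    have : 2 * (E₂ * (ε + 2 * (K ^ 2 * Real.exp (κ * (p + 1)) * (F + ε) *
        (A ^ 2 * S + A * (32 * (p + 1) ^ 2 * S) + 2 * (32 * (p + 1) ^ 2 * S))))) ≤
        2 * (E₂ * (ε + ε)) := by gcongr
    linarith
  have : F₀ ≤ F₀ / 2 := by
    calc F₀ ≤ E₁ * F := hF₀F
      _ ≤ E₁ * ((1 + 4 * E₂) * ε) := by gcongr
      _ = E₁ * (1 + 4 * E₂) * ε := by ring
      _ ≤ F₀ / 2 := hεF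
  linarith

end Main

theorem theorem4p3 {𝕜 : Type*} [RCLike 𝕜]
    (p : ENNReal) (hp₁ : 1 ≤ p) (hp : p ≠ ⊤)
    (ρ : MeasureTheory.Measure ℝ) [MeasureTheory.IsLocallyFiniteMeasure ρ]
    (hρ_unif : unifNorm ρ < ⊤) (hρ_ne : ρ ≠ 0) (hρ_per : (periods ρ).Nonempty)
    (a : ℝ → ℝ) (μ : RealLocalMeasure) (haμ : IsAM ρ a μ)
    (C : ℝ) (hC : 0 < C)
    (per : ℕ → ℝ) (hper : ∀ m, per m ∈ periods ρ) (hG : WeakGordonAlong a μ C per) :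
    ¬ ∃ z : 𝕜,
      ‖z‖ < ((MeasureTheory.eLpNorm (fun t => 1 / a t) ⊤ MeasureTheory.volume).toReal⁻¹ * C ^ 2
          - (unifNorm μ.variation).toReal) / (unifNorm ρ).toReal ∧
      IsSLEigenvalue p ρ a μ z := by
  rintro ⟨z, hz, f, hf0, u, huf, hu⟩
  simp only at huf hu
  obtain ⟨q, q₀, hqm, hq₀, hqlow, hqA, hqa⟩ := haμ.exists_representative
  set A := (eLpNorm (fun t => 1 / a t) ⊤ volume).toReal with hA
  have hA0 : 0 < A := hq₀.trans_le ((hqlow 0).trans (hqA 0))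
  set N := (unifNorm μ.variation).toReal + ‖z‖ * (unifNorm ρ).toReal with hN
  have hN0 : 0 ≤ N := by positivity
  have hAN : A * N < C ^ 2 := by
    -- for a vanishing denominator the bound on `‖z‖` would be `0`
    have hpos : 0 < (unifNorm ρ).toReal := by
      refine lt_of_le_of_ne ENNReal.toReal_nonneg fun h0 => ?_
      rw [← h0, div_zero] at hz
      exact absurd hz (not_lt.2 (norm_nonneg z))
    rw [lt_div_iff₀ hpos] at hz
    have : N < A⁻¹ * C ^ 2 := by rw [hN]; linarith
    calc A * N < A * (A⁻¹ * C ^ 2) := by gcongr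
      _ = C ^ 2 := by field_simp
  -- any `κ` with `A N ≤ κ² < C²` would do
  set κ := √((A * N + C ^ 2) / 2) with hκ
  have hκsq : κ ^ 2 = (A * N + C ^ 2) / 2 := Real.sq_sqrt (by positivity)
  have hκ0 : 0 < κ := Real.sqrt_pos.2 (by positivity)
  have hκC : κ < C := by
    refine lt_of_pow_lt_pow_left₀ 2 hC.le ?_
    rw [hκsq]; linarith
  have hANκ : A * N ≤ κ ^ 2 := by rw [hκsq]; linarith
  obtain ⟨h, hhm, hh1, hh⟩ := exists_density μ ρ z
  have hzu : ((z • f : Lp 𝕜 p ρ) : ℝ → 𝕜) =ᵐ[ρ] fun t => z * u t := by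
    filter_upwards [Lp.coeFn_smul z f, huf] with t h1 h2
    rw [h1, Pi.smul_apply, smul_eq_mul, h2]
  obtain ⟨v, huv⟩ := isSolution_of_hasSLImage haμ.a_pos hqa hhm hh1 hh hzu hu
  have hS : IsSystem A N q (dominatingMeasure μ ρ z) h :=
    ⟨hqm, fun t => hq₀.le.trans (hqlow t), hqA, hhm, hh1, hN0,
      dominatingMeasure_Ioc_le μ ρ z haμ.unif_bounded hρ_unif⟩
  have := dominatingMeasure_locallyFinite μ ρ z
  have hp0 : p ≠ 0 := (one_pos.trans_le hp₁).ne'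
  have hLp : MemLp u p ρ := (memLp_congr_ae huf).2 (Lp.memLp f)
  have hint : ∫⁻ x, ‖u x‖ₑ ^ p.toReal ∂ρ ≠ ∞ :=
    (lintegral_rpow_enorm_lt_top_of_eLpNorm_lt_top hp0 hp hLp.eLpNorm_lt_top).ne
  have hzero := hS.solution_eq_zero_of_weakGordonAlong hA0 hκ0 hκC hANκ (fun m => (hper m).2) hG
    haμ.a_pos hqa hh huv fun ε hε => hS.exists_forall_norm_le hA0 hκ0 hANκ hq₀ (hG.per_pos 0)
      (ENNReal.toReal_pos hp0 hp) hqlow huv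
      (dominatingMeasure_compl_support μ ρ z haμ.support_subset) (hper 0).2 hρ_ne hint hε
  refine hf0 ((Lp.eq_zero_iff_ae_eq_zero).2 ?_)
  filter_upwards [huf] with t ht
  rw [← ht, hzero t, Pi.zero_apply]
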